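/- **Definitions.** Let $n\ge 2$. A weighted set in $\mathbb R^n$ is a family $X=(\{x_i\}_{i=1}^N,w)$ of distinct points $x_i\in\mathbb R^n$ with weights $w(x_i)>0$. Let $r_1,\dots,r_p\ge 0$ be the distinct values of $\|x_i\|$, let $S_k$ be the sphere of radius $r_k$ centred at $0$ (with $S_k=\{0\}$ if $r_k=0$), $X_k=X\cap S_k$, $w(X_k)=\sum_{x\in X_k}w(x)$ and $S=\bigcup_{k=1}^p S_k$; we say that $X$ is supported by the $p$ concentric spheres $S_1,\dots,S_p$. For $t\ge1$, $X$ is a *Euclidean $t$-design* if for every real polynomial $f$ in $n$ variables of degree at most $t$ $$\sum_{k=1}^p\frac{w(X_k)}{|S_k|}\int_{S_k}f\,d\sigma_k=\sum_{x\in X}w(x)f(x),$$ where $\sigma_k$ is surface measure on $S_k$, $|S_k|$ is the area of $S_k$, and the mean over $\{0\}$ is $f(0)$. A *spherical $t$-design* is a finite nonempty $X\subset S^{n-1}$ with $\frac1{|S^{n-1}|}\int_{S^{n-1}}f\,d\sigma=\frac1{|X|}\sum_{x\in X}f(x)$ for all such $f$; it is regarded as a Euclidean design with constant positive weight. It is *tight*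 if $|X|=\binom{n+e-1}{n-1}+\binom{n+e-2}{n-1}$ when $t=2e$, and $|X|=2\binom{n+e-1}{n-1}$ when $t=2e+1$. Let $\mathrm{Pol}_e(\mathbb R^n)$ be the space of real polynomials of degree at most $e$, let $\mathrm{Pol}^*_e(\mathbb R^n)$ be the sum of the spaces of homogeneous polynomials of degrees $i\le e$ with $i\equiv e \pmod 2$, and let $\mathrm{Pol}_e(S)$, $\mathrm{Pol}^*_e(S)$ be the spaces of their restrictions to $S$. A Euclidean $2e$-design $X$ is a *tight Euclidean $2e$-design* if $|X|=\dim\mathrm{Pol}_e(S)=\dim\mathrm{Pol}_e(\mathbb R^n)$. A Euclidean $(2e+1)$-design $X$ with $X=-X$ and $w(x)=w(-x)$ for all $x\in X$ is an *antipodal tight Euclidean $(2e+1)$-design* if $|X^*|=\dim\mathrm{Pol}^*_e(S)=\dim\mathrm{Pol}^*_e(\mathbb R^n)$, where $X^*$ is an antipodal half of $X$, that is, $X^*\cup(-X^*)=X$ and $X^*\cap(-X^*)\subseteq\{0\}$. A Euclidean $t$-design $X=(\{x_i\}_{i=1}^N,w)$ is *strongly non-rigid* if for every $\varepsilon>0$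 there is a Euclidean $t$-design $X'=(\{x_i'\}_{i=1}^N,w')$ in $\mathbb R^n$ such that $\|x_i-x_i'\|<\varepsilon$ and $|w(x_i)-w'(x_i')|<\varepsilon$ for all $i$, and there are distinct $i,j$ with $\|x_i\|=\|x_j\|$ and $\|x_i'\|\ne\|x_j'\|$. **Theorem 3.8.** The following hold. 1. For every $n\ge2$, every tight spherical $2$-design in $S^{n-1}$, with any constant positive weight, is a tight Euclidean $2$-design and is strongly non-rigid as a Euclidean $2$-design. 2. Every antipodal tight spherical $3$-design in $S^1$, with any constant positive weight, is an antipodal tight Euclidean $3$-design and is strongly non-rigid as a Euclidean $3$-design. 3. Every tight Euclidean $4$-design in $\mathbb R^2$ supported by $2$ concentric spheres (one of which may be $\{0\}$) is strongly non-rigid. 4. Every antipodal tight Euclidean $5$-design in $\mathbb R^2$ supported by $2$ concentric circles, both of positive radius (that is, $0\notin X$), is strongly non-rigid. -/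

import Mathlib

open MeasureTheory

noncomputable section

/-- The mean value of `f` over the sphere of radius `r` about the origin of `ℝⁿ`, with respect to
the rotation-invariant surface measure, written as an integral over the unit sphere
(`x = r • u`; the factors `r ^ (n - 1)` of surface measure and surface area cancel).
For `r = 0` it is `f 0`. -/
def sphereAverage {n : ℕ} (r : ℝ) (f : EuclideanSpace ℝ (Fin n) → ℝ) : ℝ :=
  ⨍ u : Metric.sphere (0 : EuclideanSpace ℝ (Fin n)) 1,
    f (r • (u : EuclideanSpace ℝ (Fin n)))
      ∂(volume : Measure (EuclideanSpace ℝ (Fin n))).toSphere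

/-- The value of the polynomial `f ∈ ℝ[x₁, …, xₙ]` at a point of `ℝⁿ`. -/
def polyValue {n : ℕ} (f : MvPolynomial (Fin n) ℝ) (v : EuclideanSpace ℝ (Fin n)) : ℝ :=
  MvPolynomial.eval (fun k => v k) f

/-- A spherical `t`-design: finitely many distinct points of the unit sphere such that, for each
polynomial of degree at most `t`, the mean over the points is the mean over the sphere. -/
def IsSphericalDesign {n N : ℕ} (x : Fin N → EuclideanSpace ℝ (Fin n)) (t : ℕ) : Prop :=
  Function.Injective x ∧ (∀ i, ‖x i‖ = 1) ∧
    ∀ f : MvPolynomial (Fin n) ℝ, f.totalDegree ≤ t →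
      sphereAverage 1 (polyValue f) = (1 / (N : ℝ)) * ∑ i, polyValue f (x i)

/-- A tight spherical `t`-design (`t ≥ 1`): one that attains the Fisher-type bound of Delsarte,
Goethals and Seidel, which is `C(n+e-1, n-1) + C(n+e-2, n-1)` for `t = 2e` and
`2 C(n+e-1, n-1)` for `t = 2e+1`. -/
def IsTightSphericalDesign {n N : ℕ} (x : Fin N → EuclideanSpace ℝ (Fin n)) (t : ℕ) : Prop :=
  IsSphericalDesign x t ∧
    N = (n - 1 + t / 2).choose (n - 1) + (n - 1 + (t - 1) / 2).choose (n - 1)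

/-- The point set of the family is symmetric about the origin. -/
def IsAntipodal {n N : ℕ} (x : Fin N → EuclideanSpace ℝ (Fin n)) : Prop :=
  ∀ i, ∃ j, x j = -x i

/-- `H` is an antipodal half of the point set `X` of the family: `H ∪ (-H) = X`, and `H ∩ (-H)`
is `{0}` or empty. -/
def IsAntipodalHalf {n N : ℕ} (x : Fin N → EuclideanSpace ℝ (Fin n))
    (H : Set (EuclideanSpace ℝ (Fin n))) : Prop :=
  H ∪ (fun v => -v) '' H = Set.range x ∧ H ∩ (fun v => -v) '' H ⊆ {0}

/-- `Pol_e(ℝⁿ)`: the polynomials of degree at most `e`. -/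
def polSpace (n e : ℕ) : Submodule ℝ (MvPolynomial (Fin n) ℝ) :=
  MvPolynomial.restrictTotalDegree (Fin n) ℝ e

/-- `Pol*_e(ℝⁿ)`: the sum of the spaces of homogeneous polynomials of the degrees
`i ≤ e` with `i ≡ e (mod 2)`. -/
def polStarSpace (n e : ℕ) : Submodule ℝ (MvPolynomial (Fin n) ℝ) :=
  ⨆ i ∈ {i : ℕ | i ≤ e ∧ i ≡ e [MOD 2]}, MvPolynomial.homogeneousSubmodule (Fin n) ℝ i

/-- Restriction of polynomials to functions on `S ⊆ ℝⁿ`. -/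
def restrictPoly {n : ℕ} (S : Set (EuclideanSpace ℝ (Fin n))) :
    MvPolynomial (Fin n) ℝ →ₗ[ℝ] (S → ℝ) where
  toFun f := fun s => polyValue f s
  map_add' f g := by ext s; simp [polyValue]
  map_smul' c f := by ext s; simp [polyValue]

/-- The dimension of the space `V|_S` of restrictions to `S` of the polynomials in `V`. -/
def dimOn {n : ℕ} (V : Submodule ℝ (MvPolynomial (Fin n) ℝ))
    (S : Set (EuclideanSpace ℝ (Fin n))) : ℕ :=
  Module.finrank ℝ (V.map (restrictPoly S))

/-- A weighted set of `N` points `x_1, …, x_N` (distinct) of `ℝⁿ` with positive weights. -/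
structure WeightedPoints (n N : ℕ) where
  pt : Fin N → EuclideanSpace ℝ (Fin n)
  wt : Fin N → ℝ
  pt_injective : Function.Injective pt
  wt_pos : ∀ i, 0 < wt i

namespace WeightedPoints

variable {n N : ℕ}

/-- The set of radii `{‖x‖ : x ∈ X}` of the concentric spheres that support `X`
(the radius `0` is allowed, and then the sphere is the origin). -/
def radii (X : WeightedPoints n N) : Finset ℝ :=
  Finset.univ.image fun i => ‖X.pt i‖

/-- The union of the concentric spheres that support `X`. -/
def support (X : WeightedPoints n N) : Set (EuclideanSpace ℝ (Fin n)) :=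
  {v | ‖v‖ ∈ X.radii}

/-- The total weight of the points of `X` on the sphere of radius `r`. -/
def sphereWeight (X : WeightedPoints n N) (r : ℝ) : ℝ :=
  ∑ i with ‖X.pt i‖ = r, X.wt i

/-- `X` is a Euclidean `t`-design. -/
def IsEuclideanDesign (X : WeightedPoints n N) (t : ℕ) : Prop :=
  ∀ f : MvPolynomial (Fin n) ℝ, f.totalDegree ≤ t →
    ∑ r ∈ X.radii, X.sphereWeight r * sphereAverage r (polyValue f) =
      ∑ i, X.wt i * polyValue f (X.pt i)

/-- `X` is a tight Euclidean `2e`-design: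
`|X| = dim Pol_e(S) = dim Pol_e(ℝⁿ)`, where `S` is the union of the supporting spheres. -/
def IsTightEuclideanEven (X : WeightedPoints n N) (e : ℕ) : Prop :=
  X.IsEuclideanDesign (2 * e) ∧
    N = dimOn (polSpace n e) X.support ∧
    dimOn (polSpace n e) X.support = Module.finrank ℝ (polSpace n e)

/-- `X` is an antipodal tight Euclidean `(2e+1)`-design: an antipodal Euclidean `(2e+1)`-design
with `w(x) = w(-x)` and `|X*| = dim Pol*_e(S) = dim Pol*_e(ℝⁿ)`, where `X*` is an antipodal half
of `X` and `S` is the union of the supporting spheres. -/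
def IsAntipodalTightEuclideanOdd (X : WeightedPoints n N) (e : ℕ) : Prop :=
  X.IsEuclideanDesign (2 * e + 1) ∧ IsAntipodal X.pt ∧
    (∀ i j, X.pt j = -X.pt i → X.wt j = X.wt i) ∧
    (∃ H : Set (EuclideanSpace ℝ (Fin n)), IsAntipodalHalf X.pt H ∧
      H.ncard = dimOn (polStarSpace n e) X.support) ∧
    dimOn (polStarSpace n e) X.support = Module.finrank ℝ (polStarSpace n e)

/-- `X` is a Euclidean `t`-design that is strongly non-rigid: arbitrarily close to it (in points
and weights) there are Euclidean `t`-designs in which two points that had equal norms have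
different norms. -/
def IsStronglyNonRigid (X : WeightedPoints n N) (t : ℕ) : Prop :=
  X.IsEuclideanDesign t ∧
    ∀ ε : ℝ, 0 < ε → ∃ Y : WeightedPoints n N, Y.IsEuclideanDesign t ∧
      (∀ i, ‖X.pt i - Y.pt i‖ < ε ∧ |X.wt i - Y.wt i| < ε) ∧
      ∃ i j, i ≠ j ∧ ‖X.pt i‖ = ‖X.pt j‖ ∧ ‖Y.pt i‖ ≠ ‖Y.pt j‖

end WeightedPoints

end

/-! Grouping points by norm turns the design condition into the vanishing of a linear functional,
the sum of w(x) (f(x) - mean of f over the sphere through x). In the plane, with ℝ² = ℂ, the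
functions z^a conj(z)^b span the polynomials and have mean zero on circles when a ≠ b. A planar
t-design is therefore a weighted set whose moments ∑ w z^a conj(z)^b with a ≠ b, a + b ≤ t vanish
(`isEuclideanDesign_iff_moments`). Positivity of weights and distinctness of points are open
conditions, so strong non-rigidity follows from a continuous curve of designs through X that
separates two equal norms at every nearby parameter (`isStronglyNonRigid_of_curve`).

The planar designs are first classified. On one circle, conjugation gives the negative moments, and
the polynomial vanishing at the points is a linear recurrence for the moments. Hence m vanishing
power moments force at least m + 1 points, with equality only for a regular polygon of equal
weights. On two circles the moments of low degree vanish separately, because |z|² takes different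
values. A tight 4-design is thus a regular pentagon with its centre, or two oppositely placed
regular triangles; a tight 5-design avoiding 0 is a pair of squares turned by 45°. The first moment
not controlled circle by circle fixes the relative rotation and the ratio of the weights.

Each normal form then receives an explicit deformation. A square is stretched along one diagonal
with compensating weights. The two squares move in a family symmetric in both axes (`Octad`). The
six-point designs move in a family symmetric in one axis (`Hexad`), with total weight, second moment
and mixed fourth moment fixed and ρ = pq varying. If the old equalities of norms persisted there,
the rigid shape would determine ρ, so they fail for every other ρ (`IsBalanced.triangles`,
`IsBalanced.eq_zero_of_pentagon`).

In ℝⁿ a tight spherical 2-design is a regular simplex. Its apex is moved along the axis and the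
opposite face parallel to itself, the apex weight being adjusted to keep the first moment zero and
the second-moment matrix scalar. -/

noncomputable section
open scoped ComplexConjugate Pointwise

/-! ### Invariant means over spheres and the cubature defect -/

/-- The homeomorphism of the unit sphere induced by a linear isometry. -/
def sphereHomeomorph {E : Type*} [NormedAddCommGroup E] [NormedSpace ℝ E] (L : E ≃ₗᵢ[ℝ] E) :
    Metric.sphere (0 : E) 1 ≃ₜ Metric.sphere (0 : E) 1 :=
  L.toHomeomorph.subtype (fun x => by simp)

theorem coe_sphereHomeomorph {E : Type*} [NormedAddCommGroup E] [NormedSpace ℝ E]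
    (L : E ≃ₗᵢ[ℝ] E) (u : Metric.sphere (0 : E) 1) : (sphereHomeomorph L u : E) = L u := rfl

/-- The surface measure of a set is a multiple of the volume of the cone over it; an isometry
carries cones to cones and preserves volume. -/
theorem measurePreserving_sphereHomeomorph {E : Type*} [NormedAddCommGroup E]
    [InnerProductSpace ℝ E] [FiniteDimensional ℝ E] [MeasurableSpace E] [BorelSpace E]
    (L : E ≃ₗᵢ[ℝ] E) :
    MeasurePreserving (sphereHomeomorph L) (volume : Measure E).toSphere
      (volume : Measure E).toSphere := by
  refine ⟨(sphereHomeomorph L).measurable, ?_⟩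
  ext s hs
  rw [Measure.map_apply (sphereHomeomorph L).measurable hs, Measure.toSphere_apply' _ hs,
    Measure.toSphere_apply' _ ((sphereHomeomorph L).measurable hs)]
  congr 1
  have h : Set.Ioo (0 : ℝ) 1 • ((Subtype.val : Metric.sphere (0 : E) 1 → E) ''
      (sphereHomeomorph L ⁻¹' s)) = L ⁻¹' (Set.Ioo (0 : ℝ) 1 • (Subtype.val '' s)) := by
    ext x
    simp only [Set.mem_smul, Set.mem_preimage, Set.mem_image]
    constructor
    · rintro ⟨a, ha, _, ⟨y, hy, rfl⟩, rfl⟩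
      exact ⟨a, ha, _, ⟨_, hy, rfl⟩, by simp [coe_sphereHomeomorph]⟩
    · rintro ⟨a, ha, _, ⟨y, hy, rfl⟩, hx⟩
      refine ⟨a, ha, _, ⟨(sphereHomeomorph L).symm y, by simpa using hy, rfl⟩, ?_⟩
      apply L.injective
      rw [← hx, map_smul, ← coe_sphereHomeomorph, Homeomorph.apply_symm_apply]
  rw [h]
  exact (LinearIsometryEquiv.measurePreserving L).measure_preimage_emb
    L.toHomeomorph.measurableEmbedding _

/-- Mean values over the unit sphere are invariant under linear isometries. -/
theorem average_comp_isometry {E F : Type*} [NormedAddCommGroup E]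
    [InnerProductSpace ℝ E] [FiniteDimensional ℝ E] [MeasurableSpace E] [BorelSpace E]
    [NormedAddCommGroup F] [NormedSpace ℝ F]
    (L : E ≃ₗᵢ[ℝ] E) (r : ℝ) (g : E → F) :
    (⨍ u : Metric.sphere (0 : E) 1, g (L (r • (u : E))) ∂(volume : Measure E).toSphere) =
      ⨍ u : Metric.sphere (0 : E) 1, g (r • (u : E)) ∂(volume : Measure E).toSphere := by
  rw [average_eq, average_eq]
  congr 1
  simpa [coe_sphereHomeomorph] using (measurePreserving_sphereHomeomorph L).integral_comp
    (sphereHomeomorph L).measurableEmbedding fun u => g (r • (u : E))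

theorem integrable_sphere {E F : Type*} [NormedAddCommGroup E]
    [InnerProductSpace ℝ E] [FiniteDimensional ℝ E] [MeasurableSpace E] [BorelSpace E]
    [NormedAddCommGroup F] [NormedSpace ℝ F] {g : E → F} (hg : Continuous g) (r : ℝ) :
    Integrable (fun u : Metric.sphere (0 : E) 1 => g (r • (u : E)))
      (volume : Measure E).toSphere := by
  apply Continuous.integrable_of_hasCompactSupport
  · fun_prop
  · exact HasCompactSupport.of_compactSpace _

theorem continuous_polyValue {n : ℕ} (f : MvPolynomial (Fin n) ℝ) : Continuous (polyValue f) := by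
  unfold polyValue
  simp only [MvPolynomial.eval_eq]
  fun_prop

/-- The mean value over the sphere of radius `r`, as a linear functional on continuous functions. -/
def meanFunctional (𝕜 : Type*) [RCLike 𝕜] (n : ℕ) (r : ℝ) :
    C(EuclideanSpace ℝ (Fin n), 𝕜) →ₗ[𝕜] 𝕜 where
  toFun g := ⨍ u : Metric.sphere (0 : EuclideanSpace ℝ (Fin n)) 1,
    g (r • (u : EuclideanSpace ℝ (Fin n)))
      ∂(volume : Measure (EuclideanSpace ℝ (Fin n))).toSphere
  map_add' f g := by
    simp only [average_eq, ContinuousMap.add_apply]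
    rw [integral_add (integrable_sphere f.continuous r) (integrable_sphere g.continuous r),
      smul_add]
  map_smul' c g := by
    simp only [average_eq, ContinuousMap.smul_apply, RingHom.id_apply]
    rw [integral_smul, smul_comm]

theorem meanFunctional_apply (𝕜 : Type*) [RCLike 𝕜] (n : ℕ) (r : ℝ)
    (g : C(EuclideanSpace ℝ (Fin n), 𝕜)) : meanFunctional 𝕜 n r g =
    ⨍ u : Metric.sphere (0 : EuclideanSpace ℝ (Fin n)) 1, g (r • (u : EuclideanSpace ℝ (Fin n)))
      ∂(volume : Measure (EuclideanSpace ℝ (Fin n))).toSphere := rfl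

theorem meanFunctional_eq_of_invariant {𝕜 : Type*} [RCLike 𝕜] {n : ℕ} (r : ℝ)
    (L : EuclideanSpace ℝ (Fin n) ≃ₗᵢ[ℝ] EuclideanSpace ℝ (Fin n))
    (f g : C(EuclideanSpace ℝ (Fin n), 𝕜)) (h : ∀ v, f (L v) = g v) :
    meanFunctional 𝕜 n r f = meanFunctional 𝕜 n r g := by
  rw [meanFunctional_apply, meanFunctional_apply, ← average_comp_isometry L r f]
  simp only [h]

theorem meanFunctional_eq_const {𝕜 : Type*} [RCLike 𝕜] {n : ℕ} (hn : n ≠ 0) (r : ℝ) (c : 𝕜)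
    (g : C(EuclideanSpace ℝ (Fin n), 𝕜)) (h : ∀ v, ‖v‖ = |r| → g v = c) :
    meanFunctional 𝕜 n r g = c := by
  have : Nontrivial (EuclideanSpace ℝ (Fin n)) := by
    have : NeZero n := ⟨hn⟩
    infer_instance
  have : NeZero ((volume : Measure (EuclideanSpace ℝ (Fin n))).toSphere) :=
    ⟨Measure.toSphere_ne_zero _⟩
  rw [meanFunctional_apply]
  have : (fun u : Metric.sphere (0 : EuclideanSpace ℝ (Fin n)) 1 =>
      g (r • (u : EuclideanSpace ℝ (Fin n)))) = fun _ => c := by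
    funext u
    apply h
    simp [norm_smul]
  rw [this, average_const]

/-- A polynomial as a continuous function. -/
def polyMap {n : ℕ} (f : MvPolynomial (Fin n) ℝ) : C(EuclideanSpace ℝ (Fin n), ℝ) :=
  ⟨polyValue f, continuous_polyValue f⟩

theorem sphereAverage_eq {n : ℕ} (r : ℝ) (f : MvPolynomial (Fin n) ℝ) :
    sphereAverage r (polyValue f) = meanFunctional ℝ n r (polyMap f) := rfl

namespace WeightedPoints
variable {n N : ℕ}

theorem sum_radii_mul (X : WeightedPoints n N) (F : ℝ → ℝ) :
    ∑ r ∈ X.radii, X.sphereWeight r * F r = ∑ i, X.wt i * F ‖X.pt i‖ := by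
  rw [← Finset.sum_fiberwise_of_maps_to (s := Finset.univ) (t := X.radii)
    (g := fun i => ‖X.pt i‖) (fun i _ => Finset.mem_image_of_mem _ (Finset.mem_univ i))]
  refine Finset.sum_congr rfl fun r _ => ?_
  rw [sphereWeight, Finset.sum_mul]
  refine Finset.sum_congr rfl fun i hi => ?_
  rw [(Finset.mem_filter.1 hi).2]

/-- The defect of the cubature formula attached to a weighted set, as a linear functional. -/
def defect (𝕜 : Type*) [RCLike 𝕜] (X : WeightedPoints n N) :
    C(EuclideanSpace ℝ (Fin n), 𝕜) →ₗ[𝕜] 𝕜 where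
  toFun g := ∑ i, (X.wt i : 𝕜) * (g (X.pt i) - meanFunctional 𝕜 n ‖X.pt i‖ g)
  map_add' f g := by
    rw [← Finset.sum_add_distrib]
    refine Finset.sum_congr rfl fun i _ => ?_
    rw [map_add, ContinuousMap.add_apply]
    ring
  map_smul' c g := by
    rw [RingHom.id_apply, smul_eq_mul, Finset.mul_sum]
    refine Finset.sum_congr rfl fun i _ => ?_
    rw [map_smul, ContinuousMap.smul_apply, smul_eq_mul, smul_eq_mul]
    ring

theorem defect_apply (𝕜 : Type*) [RCLike 𝕜] (X : WeightedPoints n N)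
    (g : C(EuclideanSpace ℝ (Fin n), 𝕜)) : X.defect 𝕜 g =
      ∑ i, (X.wt i : 𝕜) * (g (X.pt i) - meanFunctional 𝕜 n ‖X.pt i‖ g) := rfl

theorem isEuclideanDesign_iff_defect (X : WeightedPoints n N) (t : ℕ) :
    X.IsEuclideanDesign t ↔
      ∀ f : MvPolynomial (Fin n) ℝ, f.totalDegree ≤ t → X.defect ℝ (polyMap f) = 0 := by
  refine forall₂_congr fun f _ => ?_
  rw [X.sum_radii_mul fun r => sphereAverage r (polyValue f), eq_comm, ← sub_eq_zero,
    ← Finset.sum_sub_distrib, defect_apply]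
  simp only [sphereAverage_eq, mul_sub]
  rfl

end WeightedPoints
end

/-! ### Planar designs as complex moment conditions -/

noncomputable section
open scoped ComplexConjugate

/-- The standard isometry from `ℂ` to the Euclidean plane. -/
def planeIsometry : ℂ ≃ₗᵢ[ℝ] EuclideanSpace ℝ (Fin 2) := Complex.orthonormalBasisOneI.repr

theorem planeIsometry_apply_zero (z : ℂ) : planeIsometry z 0 = z.re := by
  simp [planeIsometry]

theorem planeIsometry_apply_one (z : ℂ) : planeIsometry z 1 = z.im := by
  simp [planeIsometry]

theorem planeIsometry_symm_eq (v : EuclideanSpace ℝ (Fin 2)) :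
    planeIsometry.symm v = (v 0 : ℂ) + (v 1 : ℂ) * Complex.I := by
  obtain ⟨z, rfl⟩ := planeIsometry.surjective v
  rw [planeIsometry.symm_apply_apply, planeIsometry_apply_zero, planeIsometry_apply_one,
    Complex.re_add_im]

/-- The function `z ^ a * conj z ^ b` on the plane. -/
def mixedPower (a b : ℕ) : C(EuclideanSpace ℝ (Fin 2), ℂ) :=
  ⟨fun v => planeIsometry.symm v ^ a * conj (planeIsometry.symm v) ^ b, by
    have := planeIsometry.symm.continuous
    fun_prop⟩

theorem mixedPower_apply (a b : ℕ) (v : EuclideanSpace ℝ (Fin 2)) :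
    mixedPower a b v = planeIsometry.symm v ^ a * conj (planeIsometry.symm v) ^ b := rfl

theorem meanFunctional_mixedPower_self (r : ℝ) (a : ℕ) :
    meanFunctional ℂ 2 r (mixedPower a a) = ((r ^ 2 : ℝ) : ℂ) ^ a := by
  apply meanFunctional_eq_const two_ne_zero
  intro v hv
  rw [mixedPower_apply, ← mul_pow, Complex.mul_conj, Complex.normSq_eq_norm_sq,
    LinearIsometryEquiv.norm_map, hv, sq_abs]

/-- Rotation by π/(a - b) multiplies z^a conj(z)^b by -1 and preserves the mean, so the mean equals
its own negative. -/
theorem meanFunctional_mixedPower_of_ne (r : ℝ) {a b : ℕ} (hab : a ≠ b) :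
    meanFunctional ℂ 2 r (mixedPower a b) = 0 := by
  set θ : ℝ := Real.pi / ((a : ℝ) - b) with hθ
  have hd : (a : ℝ) - b ≠ 0 := sub_ne_zero.2 (by exact_mod_cast hab)
  set c : Circle := Circle.exp θ with hc
  have hc1 : (c : ℂ) ^ a * conj (c : ℂ) ^ b = -1 := by
    rw [← Circle.coe_inv_eq_conj, hc, ← Circle.exp_neg, Circle.coe_exp, Circle.coe_exp,
      ← Complex.exp_nat_mul, ← Complex.exp_nat_mul, ← Complex.exp_add, ← Complex.exp_pi_mul_I]
    congr 1
    have h : (a : ℂ) * θ - b * θ = Real.pi := by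
      have : (a : ℝ) * θ - b * θ = Real.pi := by rw [hθ]; field_simp
      exact_mod_cast this
    push_cast
    linear_combination Complex.I * h
  have h := meanFunctional_eq_of_invariant (𝕜 := ℂ) r
    ((planeIsometry.symm.trans (rotation c)).trans planeIsometry)
    (mixedPower a b) ((-1 : ℂ) • mixedPower a b) (fun v => by
      simp only [mixedPower_apply, ContinuousMap.smul_apply, LinearIsometryEquiv.trans_apply,
        LinearIsometryEquiv.symm_apply_apply, rotation_apply, map_mul, mul_pow, smul_eq_mul]
      linear_combination (planeIsometry.symm v ^ a * conj (planeIsometry.symm v) ^ b) * hc1)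
  rw [map_smul, smul_eq_mul] at h
  linear_combination h / 2

/-- The complex span of the functions `z ^ a * conj z ^ b` with `a + b ≤ t`. -/
def mixedSpan (t : ℕ) : Submodule ℂ C(EuclideanSpace ℝ (Fin 2), ℂ) :=
  Submodule.span ℂ {g | ∃ a b, a + b ≤ t ∧ g = mixedPower a b}

theorem mixedPower_mem_mixedSpan {a b t : ℕ} (h : a + b ≤ t) : mixedPower a b ∈ mixedSpan t :=
  Submodule.subset_span ⟨a, b, h, rfl⟩

theorem mixedSpan_mono {s t : ℕ} (h : s ≤ t) : mixedSpan s ≤ mixedSpan t :=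
  Submodule.span_mono fun _ ⟨a, b, hab, hg⟩ => ⟨a, b, hab.trans h, hg⟩

theorem mixedPower_mul (a b c d : ℕ) :
    mixedPower a b * mixedPower c d = mixedPower (a + c) (b + d) := by
  ext v
  simp only [ContinuousMap.mul_apply, mixedPower_apply]
  ring

theorem mul_mem_mixedSpan {s t : ℕ} {f g : C(EuclideanSpace ℝ (Fin 2), ℂ)}
    (hf : f ∈ mixedSpan s) (hg : g ∈ mixedSpan t) : f * g ∈ mixedSpan (s + t) := by
  induction hf using Submodule.span_induction with
  | mem f hf =>
    obtain ⟨a, b, hab, rfl⟩ := hf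
    induction hg using Submodule.span_induction with
    | mem g hg =>
      obtain ⟨c, d, hcd, rfl⟩ := hg
      rw [mixedPower_mul]
      exact mixedPower_mem_mixedSpan (by omega)
    | zero => simp
    | add x y _ _ hx hy => rw [mul_add]; exact add_mem hx hy
    | smul k x _ hx => rw [mul_smul_comm]; exact Submodule.smul_mem _ _ hx
  | zero => simp
  | add x y _ _ hx hy => rw [add_mul]; exact add_mem hx hy
  | smul k x _ hx => rw [smul_mul_assoc]; exact Submodule.smul_mem _ _ hx

theorem pow_mem_mixedSpan {f : C(EuclideanSpace ℝ (Fin 2), ℂ)}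
    (hf : f ∈ mixedSpan 1) (k : ℕ) : f ^ k ∈ mixedSpan k := by
  induction k with
  | zero =>
    have : (1 : C(EuclideanSpace ℝ (Fin 2), ℂ)) = mixedPower 0 0 := by
      ext v; simp [mixedPower_apply]
    rw [pow_zero, this]
    exact mixedPower_mem_mixedSpan le_rfl
  | succ k ih => rw [pow_succ]; exact mul_mem_mixedSpan ih hf

/-- A real polynomial as a complex-valued continuous function. -/
def complexPolyMap (f : MvPolynomial (Fin 2) ℝ) : C(EuclideanSpace ℝ (Fin 2), ℂ) :=
  ⟨fun v => (polyValue f v : ℂ), by have := continuous_polyValue f; fun_prop⟩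

theorem complexPolyMap_apply (f : MvPolynomial (Fin 2) ℝ) (v : EuclideanSpace ℝ (Fin 2)) :
    complexPolyMap f v = (polyValue f v : ℂ) := rfl

theorem complexPolyMap_mem_mixedSpan (f : MvPolynomial (Fin 2) ℝ) {t : ℕ}
    (hf : f.totalDegree ≤ t) : complexPolyMap f ∈ mixedSpan t := by
  set x : C(EuclideanSpace ℝ (Fin 2), ℂ) := (1 / 2 : ℂ) • (mixedPower 1 0 + mixedPower 0 1)
  set y : C(EuclideanSpace ℝ (Fin 2), ℂ) :=
    (-Complex.I / 2 : ℂ) • (mixedPower 1 0 - mixedPower 0 1)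
  have hx : x ∈ mixedSpan 1 := Submodule.smul_mem _ _
    (add_mem (mixedPower_mem_mixedSpan le_rfl) (mixedPower_mem_mixedSpan le_rfl))
  have hy : y ∈ mixedSpan 1 := Submodule.smul_mem _ _
    (sub_mem (mixedPower_mem_mixedSpan le_rfl) (mixedPower_mem_mixedSpan le_rfl))
  have hxv : ∀ v, x v = (v 0 : ℂ) := fun v => by
    simp [x, mixedPower_apply, planeIsometry_symm_eq]
    ring
  have hyv : ∀ v, y v = (v 1 : ℂ) := fun v => by
    simp [y, mixedPower_apply, planeIsometry_symm_eq]
    linear_combination (-(v 1 : ℂ)) * Complex.I_sq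
  have h : complexPolyMap f = ∑ m ∈ f.support, ((f.coeff m : ℝ) : ℂ) • (x ^ m 0 * y ^ m 1) := by
    ext v
    simp only [complexPolyMap_apply, polyValue, MvPolynomial.eval_eq', Fin.prod_univ_two,
      ContinuousMap.sum_apply, ContinuousMap.smul_apply, ContinuousMap.mul_apply,
      ContinuousMap.pow_apply, hxv, hyv, smul_eq_mul]
    push_cast
    rfl
  rw [h]
  refine Submodule.sum_mem _ fun m hm => Submodule.smul_mem _ _ ?_
  refine mixedSpan_mono ?_ (mul_mem_mixedSpan (pow_mem_mixedSpan hx _) (pow_mem_mixedSpan hy _))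
  have := MvPolynomial.le_totalDegree hm
  rw [Finsupp.sum_fintype _ _ (fun _ => rfl), Fin.sum_univ_two] at this
  omega

theorem exists_poly_mixedPower (a b : ℕ) : ∃ f g : MvPolynomial (Fin 2) ℝ,
    f.totalDegree ≤ a + b ∧ g.totalDegree ≤ a + b ∧
      mixedPower a b = complexPolyMap f + Complex.I • complexPolyMap g := by
  -- Multiplication by z (s = 1) or by conj z (s = -1) raises the degree of the real and imaginary
  -- parts by at most one.
  have key : ∀ (k : ℕ) (s : ℝ) (f g : MvPolynomial (Fin 2) ℝ), f.totalDegree ≤ k →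
      g.totalDegree ≤ k → ∃ f' g' : MvPolynomial (Fin 2) ℝ, f'.totalDegree ≤ k + 1 ∧
        g'.totalDegree ≤ k + 1 ∧ ∀ v : EuclideanSpace ℝ (Fin 2),
        ((polyValue f v : ℂ) + Complex.I * polyValue g v) * (v 0 + s * v 1 * Complex.I) =
          polyValue f' v + Complex.I * polyValue g' v := by
    intro k s f g hf hg
    have hX : ∀ (h : MvPolynomial (Fin 2) ℝ) (i : Fin 2), h.totalDegree ≤ k →
        (h * MvPolynomial.X i).totalDegree ≤ k + 1 := fun h i hh =>
      (MvPolynomial.totalDegree_mul _ _).trans (by rw [MvPolynomial.totalDegree_X]; omega)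
    refine ⟨f * MvPolynomial.X 0 - s • (g * MvPolynomial.X 1),
      g * MvPolynomial.X 0 + s • (f * MvPolynomial.X 1), ?_, ?_, ?_⟩
    · exact (MvPolynomial.totalDegree_sub _ _).trans (max_le (hX f 0 hf)
        ((MvPolynomial.totalDegree_smul_le _ _).trans (hX g 1 hg)))
    · exact (MvPolynomial.totalDegree_add _ _).trans (max_le (hX g 0 hg)
        ((MvPolynomial.totalDegree_smul_le _ _).trans (hX f 1 hf)))
    · intro v
      simp only [polyValue, map_sub, map_add, map_mul, MvPolynomial.eval_X, MvPolynomial.smul_eval]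
      push_cast
      linear_combination ((s : ℂ) * v 1 * MvPolynomial.eval (fun k => v k) g) * Complex.I_sq
  have h : ∃ f g : MvPolynomial (Fin 2) ℝ, f.totalDegree ≤ a + b ∧ g.totalDegree ≤ a + b ∧
      ∀ v : EuclideanSpace ℝ (Fin 2), mixedPower a b v =
        polyValue f v + Complex.I * polyValue g v := by
    induction a with
    | zero =>
      induction b with
      | zero => exact ⟨1, 0, by simp, by simp, fun v => by simp [mixedPower_apply, polyValue]⟩
      | succ b ih =>
        obtain ⟨f, g, hf, hg, h⟩ := ih
        obtain ⟨f', g', hf', hg', h'⟩ := key _ (-1) f g hf hg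
        refine ⟨f', g', by omega, by omega, fun v => ?_⟩
        rw [← h', ← h, mixedPower_apply, mixedPower_apply, planeIsometry_symm_eq]
        simp only [map_add, map_mul, Complex.conj_ofReal, Complex.conj_I]
        push_cast
        ring
    | succ a ih =>
      obtain ⟨f, g, hf, hg, h⟩ := ih
      obtain ⟨f', g', hf', hg', h'⟩ := key _ 1 f g hf hg
      refine ⟨f', g', by omega, by omega, fun v => ?_⟩
      rw [← h', ← h, mixedPower_apply, mixedPower_apply, planeIsometry_symm_eq]
      push_cast
      ring
  obtain ⟨f, g, hf, hg, h⟩ := h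
  exact ⟨f, g, hf, hg, by ext v; simp [h, complexPolyMap_apply]⟩

theorem meanFunctional_complexPolyMap (r : ℝ) (f : MvPolynomial (Fin 2) ℝ) :
    meanFunctional ℂ 2 r (complexPolyMap f) = (meanFunctional ℝ 2 r (polyMap f) : ℝ) := by
  simp only [meanFunctional_apply, average_eq, complexPolyMap_apply]
  rw [integral_complex_ofReal, Complex.real_smul, ← Complex.ofReal_mul]
  rfl

namespace WeightedPoints
variable {N : ℕ}

theorem defect_complexPolyMap (X : WeightedPoints 2 N) (f : MvPolynomial (Fin 2) ℝ) :
    X.defect ℂ (complexPolyMap f) = (X.defect ℝ (polyMap f) : ℝ) := by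
  simp only [defect_apply, meanFunctional_complexPolyMap, complexPolyMap_apply]
  push_cast
  rfl

theorem defect_mixedPower (X : WeightedPoints 2 N) (a b : ℕ) :
    X.defect ℂ (mixedPower a b) = if a = b then 0 else
      ∑ i, (X.wt i : ℂ) *
        (planeIsometry.symm (X.pt i) ^ a * conj (planeIsometry.symm (X.pt i)) ^ b) := by
  rw [defect_apply]
  split_ifs with h
  · subst h
    refine Finset.sum_eq_zero fun i _ => ?_
    rw [meanFunctional_mixedPower_self, mixedPower_apply, ← mul_pow, Complex.mul_conj,
      Complex.normSq_eq_norm_sq, LinearIsometryEquiv.norm_map, sub_self, mul_zero]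
  · simp only [meanFunctional_mixedPower_of_ne _ h, sub_zero]
    rfl

/-- A weighted set in the plane is a Euclidean `t`-design if and only if its moments
`∑ w z ^ a (conj z) ^ b` with `a ≠ b` and `a + b ≤ t` vanish. -/
theorem isEuclideanDesign_iff_moments (X : WeightedPoints 2 N) (t : ℕ) :
    X.IsEuclideanDesign t ↔ ∀ a b : ℕ, a + b ≤ t → a ≠ b →
      ∑ i, (X.wt i : ℂ) *
        (planeIsometry.symm (X.pt i) ^ a * conj (planeIsometry.symm (X.pt i)) ^ b) = 0 := by
  rw [isEuclideanDesign_iff_defect]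
  constructor
  · intro h a b hab hne
    obtain ⟨f, g, hf, hg, hfg⟩ := exists_poly_mixedPower a b
    have := X.defect_mixedPower a b
    rw [if_neg hne] at this
    rw [← this, hfg, map_add, map_smul, defect_complexPolyMap, defect_complexPolyMap,
      h f (hf.trans hab), h g (hg.trans hab)]
    simp
  · intro h f hf
    have hker : mixedSpan t ≤ LinearMap.ker (X.defect ℂ) := by
      refine Submodule.span_le.2 ?_
      rintro _ ⟨a, b, hab, rfl⟩
      rw [SetLike.mem_coe, LinearMap.mem_ker, defect_mixedPower]
      split_ifs with hne
      · rfl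
      · exact h a b hab hne
    have := hker (complexPolyMap_mem_mixedSpan f hf)
    rw [LinearMap.mem_ker, defect_complexPolyMap] at this
    exact_mod_cast this

end WeightedPoints
end

/-! ### Non-rigidity from a curve of designs -/

noncomputable section
open scoped ComplexConjugate Topology

theorem conj_moment {ι : Type*} [Fintype ι] (w : ι → ℝ) (z : ι → ℂ) (a b : ℕ) :
    conj (∑ i, (w i : ℂ) * (z i ^ a * conj (z i) ^ b)) =
      ∑ i, (w i : ℂ) * (z i ^ b * conj (z i) ^ a) := by
  rw [map_sum]
  refine Finset.sum_congr rfl fun i _ => ?_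
  simp only [map_mul, map_pow, Complex.conj_ofReal, Complex.conj_conj]
  ring

namespace WeightedPoints

/-- Closeness, positive weights and distinct points hold near τ₀ by continuity. Only the design
property and the separation of norms need proof, and only for τ ≠ τ₀, since at τ₀ the norms agree.
-/
theorem isStronglyNonRigid_of_curve {n N t : ℕ} (X : WeightedPoints n N)
    (hX : X.IsEuclideanDesign t) (P : ℝ → Fin N → EuclideanSpace ℝ (Fin n)) (W : ℝ → Fin N → ℝ)
    (τ₀ : ℝ) (hP : ∀ i, ContinuousAt (fun τ => P τ i) τ₀)
    (hW : ∀ i, ContinuousAt (fun τ => W τ i) τ₀) (hP0 : ∀ i, P τ₀ i = X.pt i)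
    (hW0 : ∀ i, W τ₀ i = X.wt i)
    (h : ∀ᶠ τ in 𝓝[≠] τ₀, (∀ Y : WeightedPoints n N, Y.pt = P τ → Y.wt = W τ →
      Y.IsEuclideanDesign t) ∧
      ∃ i j, i ≠ j ∧ ‖X.pt i‖ = ‖X.pt j‖ ∧ ‖P τ i‖ ≠ ‖P τ j‖) :
    X.IsStronglyNonRigid t := by
  refine ⟨hX, fun ε hε => ?_⟩
  have h1 : ∀ᶠ τ in 𝓝 τ₀, ∀ i, ‖X.pt i - P τ i‖ < ε := by
    refine Filter.eventually_all.2 fun i => ?_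
    have : ContinuousAt (fun τ => ‖X.pt i - P τ i‖) τ₀ := (continuousAt_const.sub (hP i)).norm
    exact this.eventually_lt continuousAt_const (by simpa [hP0] using hε)
  have h2 : ∀ᶠ τ in 𝓝 τ₀, ∀ i, |X.wt i - W τ i| < ε := by
    refine Filter.eventually_all.2 fun i => ?_
    have : ContinuousAt (fun τ => |X.wt i - W τ i|) τ₀ := (continuousAt_const.sub (hW i)).abs
    exact this.eventually_lt continuousAt_const (by simpa [hW0] using hε)
  have h3 : ∀ᶠ τ in 𝓝 τ₀, ∀ i, 0 < W τ i := by
    refine Filter.eventually_all.2 fun i => ?_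
    exact continuousAt_const.eventually_lt (hW i) (by rw [hW0]; exact X.wt_pos i)
  have h4 : ∀ᶠ τ in 𝓝 τ₀, ∀ i j, i ≠ j → P τ i ≠ P τ j := by
    refine Filter.eventually_all.2 fun i => Filter.eventually_all.2 fun j => ?_
    by_cases hij : i = j
    · exact Filter.Eventually.of_forall fun _ h => absurd hij h
    · filter_upwards [((hP i).sub (hP j)).eventually_ne (y := 0)
          (by simpa [hP0, sub_eq_zero] using fun h => hij (X.pt_injective h))] with τ hτ _
      exact sub_ne_zero.1 hτ
  obtain ⟨τ, ⟨hdes, i, j, hij, hX, hY⟩, h1, h2, h3, h4⟩ :=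
    (h.and ((h1.and (h2.and (h3.and h4))).filter_mono nhdsWithin_le_nhds)).exists
  let Y : WeightedPoints n N := ⟨P τ, W τ, fun i j hij => by
    by_contra hne; exact h4 i j hne hij, h3⟩
  exact ⟨Y, hdes Y rfl rfl, fun i => ⟨h1 i, h2 i⟩, i, j, hij, hX, hY⟩

/-- The planar form of `isStronglyNonRigid_of_curve`, up to a similarity and a common factor of
the weights. -/
theorem isStronglyNonRigid_of_planar_curve {N t : ℕ} {ι : Type*} [Fintype ι]
    (X : WeightedPoints 2 N) (hX : X.IsEuclideanDesign t) (e : Fin N ≃ ι)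
    (ζ : ℂ) (hζ : ζ ≠ 0) (c : ℝ) (Z : ℝ → ι → ℂ) (W : ℝ → ι → ℝ) (τ₀ : ℝ)
    (hZ : ∀ k, ContinuousAt (fun τ => Z τ k) τ₀) (hW : ∀ k, ContinuousAt (fun τ => W τ k) τ₀)
    (hZ0 : ∀ i, planeIsometry.symm (X.pt i) = ζ * Z τ₀ (e i))
    (hW0 : ∀ i, X.wt i = c * W τ₀ (e i))
    (hdes : ∀ᶠ τ in 𝓝[≠] τ₀, ∀ a b : ℕ, a + b ≤ t → b < a →
      ∑ k, (W τ k : ℂ) * (Z τ k ^ a * conj (Z τ k) ^ b) = 0)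
    (hnorm : ∀ᶠ τ in 𝓝[≠] τ₀, ∃ k l, ‖Z τ₀ k‖ = ‖Z τ₀ l‖ ∧ ‖Z τ k‖ ≠ ‖Z τ l‖) :
    X.IsStronglyNonRigid t := by
  refine X.isStronglyNonRigid_of_curve hX (fun τ i => planeIsometry (ζ * Z τ (e i)))
    (fun τ i => c * W τ (e i)) τ₀ (fun i => ?_) (fun i => continuousAt_const.mul (hW _))
    (fun i => by rw [← hZ0, LinearIsometryEquiv.apply_symm_apply]) (fun i => (hW0 i).symm) ?_
  · exact planeIsometry.continuous.continuousAt.comp (continuousAt_const.mul (hZ _))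
  · filter_upwards [hdes, hnorm] with τ hd hn
    constructor
    · intro Y hYp hYw
      rw [isEuclideanDesign_iff_moments]
      have main : ∀ a b : ℕ, a + b ≤ t → b < a → ∑ i, (Y.wt i : ℂ) *
          (planeIsometry.symm (Y.pt i) ^ a * conj (planeIsometry.symm (Y.pt i)) ^ b) = 0 := by
        intro a b hab hlt
        rw [hYp, hYw]
        simp only [LinearIsometryEquiv.symm_apply_apply]
        rw [Equiv.sum_comp e fun k => ((c * W τ k : ℝ) : ℂ) *
          ((ζ * Z τ k) ^ a * conj (ζ * Z τ k) ^ b)]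
        have := hd a b hab hlt
        calc _ = c * ζ ^ a * conj ζ ^ b *
              ∑ k, (W τ k : ℂ) * (Z τ k ^ a * conj (Z τ k) ^ b) := by
              rw [Finset.mul_sum]
              refine Finset.sum_congr rfl fun k _ => ?_
              rw [map_mul]
              push_cast
              ring
          _ = 0 := by rw [this, mul_zero]
      -- The case a < b follows by complex conjugation, which exchanges the exponents.
      intro a b hab hne
      rcases lt_or_gt_of_ne hne with h | h
      · rw [← conj_moment, main b a (by omega) h, map_zero]
      · exact main a b hab h
    · obtain ⟨k, l, h0, h1⟩ := hn
      refine ⟨e.symm k, e.symm l, ?_, ?_, ?_⟩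
      · rintro h
        rw [e.symm.injective h] at h1
        exact h1 rfl
      · rw [← planeIsometry.symm.norm_map, hZ0, ← planeIsometry.symm.norm_map (X.pt (e.symm l)),
          hZ0]
        simp [h0]
      · simpa [hζ] using h1

end WeightedPoints

/-! ### Weighted points on one circle -/

section Circle

variable {ι : Type*} {s : Finset ι} {w : ι → ℝ} {z : ι → ℂ} {r : ℝ} {m : ℕ}

/-- On the circle conj z = r²/z, so conjugating a positive moment gives, up to a factor, the
negative one. -/
theorem zpow_moment_eq_zero (hr : 0 < r) (hz : ∀ i ∈ s, ‖z i‖ = r)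
    (hm : ∀ k, 1 ≤ k → k ≤ m → ∑ i ∈ s, (w i : ℂ) * z i ^ k = 0) {k : ℤ} (hk : k ≠ 0)
    (hkm : |k| ≤ m) : ∑ i ∈ s, (w i : ℂ) * z i ^ k = 0 := by
  obtain ⟨l, rfl | rfl⟩ := k.eq_nat_or_neg
  · have := hm l (by omega) (by simpa using hkm)
    simpa using this
  · have h := hm l (by omega) (by simpa using hkm)
    have h' := congrArg (fun x => ((r : ℂ) ^ 2)⁻¹ ^ l * conj x) h
    simp only [map_zero, mul_zero, map_sum, Finset.mul_sum] at h'
    rw [← h']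
    refine Finset.sum_congr rfl fun i hi => ?_
    have hzi : z i ≠ 0 := by
      rw [← norm_pos_iff, hz i hi]; exact hr
    have hc : conj (z i) = (r : ℂ) ^ 2 * (z i)⁻¹ := by
      rw [eq_mul_inv_iff_mul_eq₀ hzi, mul_comm, Complex.mul_conj, Complex.normSq_eq_norm_sq,
        hz i hi]
      push_cast
      rfl
    have hr' : (r : ℂ) ≠ 0 := by exact_mod_cast hr.ne'
    simp only [map_mul, map_pow, Complex.conj_ofReal, hc, zpow_neg, zpow_natCast, mul_pow, inv_pow]
    field_simp

/-- Every z i is a root of the product polynomial, so its coefficients form a linear recurrence for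
the moments; the shift l will place the zeroth moment at a chosen coefficient. -/
theorem sum_coeff_mul_moment (hz : ∀ i ∈ s, z i ≠ 0) (l : ℤ) :
    ∑ k ∈ Finset.range (s.card + 1), (∏ i ∈ s, (Polynomial.X - Polynomial.C (z i))).coeff k *
      ∑ i ∈ s, (w i : ℂ) * z i ^ ((k : ℤ) - l) = 0 := by
  set P : Polynomial ℂ := ∏ i ∈ s, (Polynomial.X - Polynomial.C (z i)) with hP
  have hdeg : P.natDegree = s.card := Polynomial.natDegree_finsetProd_X_sub_C_eq_card s z
  simp only [Finset.mul_sum]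
  rw [Finset.sum_comm]
  refine Finset.sum_eq_zero fun i hi => ?_
  have h0 : P.eval (z i) = 0 := by
    rw [hP, Polynomial.eval_prod]
    exact Finset.prod_eq_zero hi (by simp)
  rw [Polynomial.eval_eq_sum_range, hdeg] at h0
  calc _ = (w i : ℂ) * z i ^ (-l) * ∑ k ∈ Finset.range (s.card + 1), P.coeff k * z i ^ k := by
        rw [Finset.mul_sum]
        refine Finset.sum_congr rfl fun k _ => ?_
        rw [sub_eq_add_neg, zpow_add₀ (hz i hi), zpow_natCast]
        ring
    _ = 0 := by rw [h0, mul_zero]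

/-- A weighted set on a circle whose first `m` power moments vanish has more than `m` points. -/
theorem lt_card_of_moments (hr : 0 < r) (hz : ∀ i ∈ s, ‖z i‖ = r) (hw : 0 < ∑ i ∈ s, w i)
    (hm : ∀ k, 1 ≤ k → k ≤ m → ∑ i ∈ s, (w i : ℂ) * z i ^ k = 0) : m < s.card := by
  by_contra hlt
  push Not at hlt
  have hz0 : ∀ i ∈ s, z i ≠ 0 := fun i hi => by rw [← norm_pos_iff, hz i hi]; exact hr
  -- With l the degree, the zeroth moment meets the leading coefficient 1 and all other exponents
  -- lie between -m and -1. The total weight would have to vanish.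
  have h := sum_coeff_mul_moment (w := w) hz0 (s.card : ℤ)
  rw [Finset.sum_range_succ, Finset.sum_eq_zero, zero_add] at h
  · have hmon := (Polynomial.monic_prod_X_sub_C z s).coeff_natDegree
    rw [Polynomial.natDegree_finsetProd_X_sub_C_eq_card] at hmon
    rw [hmon] at h
    simp only [sub_self, zpow_zero, mul_one, one_mul] at h
    exact hw.ne' (by exact_mod_cast h)
  · intro k hk
    have := Finset.mem_range.1 hk
    rw [zpow_moment_eq_zero hr hz hm (by omega) (by rw [abs_le]; omega), mul_zero]

/-- In the extremal case of `lt_card_of_moments` the points have equal `(m+1)`-st powers. -/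
theorem exists_pow_eq_of_moments (hr : 0 < r) (hz : ∀ i ∈ s, ‖z i‖ = r) (hw : 0 < ∑ i ∈ s, w i)
    (hm : ∀ k, 1 ≤ k → k ≤ m → ∑ i ∈ s, (w i : ℂ) * z i ^ k = 0) (hcard : s.card = m + 1) :
    ∃ c : ℂ, ∀ i ∈ s, z i ^ (m + 1) = c := by
  have hz0 : ∀ i ∈ s, z i ≠ 0 := fun i hi => by rw [← norm_pos_iff, hz i hi]; exact hr
  set P : Polynomial ℂ := ∏ i ∈ s, (Polynomial.X - Polynomial.C (z i)) with hP
  have hdeg : P.natDegree = m + 1 := by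
    rw [hP, Polynomial.natDegree_finsetProd_X_sub_C_eq_card, hcard]
  have hcoeff : ∀ l, 1 ≤ l → l ≤ m → P.coeff l = 0 := by
    intro l hl hlm
    -- For 1 ≤ l ≤ m the exponents k - l stay between -m and m, so only the coefficient at l
    -- survives, multiplied by the total weight. Hence the polynomial is X^(m+1) plus a constant.
    have h := sum_coeff_mul_moment (w := w) hz0 (l : ℤ)
    rw [Finset.sum_eq_single l] at h
    · rw [mul_eq_zero] at h
      refine h.resolve_right ?_
      simp only [sub_self, zpow_zero, mul_one]
      exact_mod_cast hw.ne'
    · intro k hk hkl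
      have := Finset.mem_range.1 hk
      rw [zpow_moment_eq_zero hr hz hm (by omega) (by rw [abs_le]; omega), mul_zero]
    · intro hl'
      exact absurd (Finset.mem_range.2 (by omega)) hl'
  refine ⟨-P.coeff 0, fun i hi => ?_⟩
  have h0 : P.eval (z i) = 0 := by
    rw [hP, Polynomial.eval_prod]
    exact Finset.prod_eq_zero hi (by simp)
  have hmon : P.coeff (m + 1) = 1 := by
    rw [← hdeg]; exact (Polynomial.monic_prod_X_sub_C z s).coeff_natDegree
  rw [Polynomial.eval_eq_sum_range, hdeg, Finset.sum_range_succ, Finset.sum_range_succ',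
    Finset.sum_eq_zero, hmon] at h0
  · linear_combination h0
  · intro k hk
    have := Finset.mem_range.1 hk
    rw [hcoeff (k + 1) (by omega) (by omega), zero_mul]

/-- In the extremal case of `lt_card_of_moments` the weights are equal. -/
theorem weight_eq_of_moments (hr : 0 < r) (hz : ∀ i ∈ s, ‖z i‖ = r) (hw : 0 < ∑ i ∈ s, w i)
    (hinj : Set.InjOn z s)
    (hm : ∀ k, 1 ≤ k → k ≤ m → ∑ i ∈ s, (w i : ℂ) * z i ^ k = 0) (hcard : s.card = m + 1)
    {i : ι} (hi : i ∈ s) : (m + 1) * w i = ∑ j ∈ s, w j := by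
  have hz0 : ∀ i ∈ s, z i ≠ 0 := fun i hi => by rw [← norm_pos_iff, hz i hi]; exact hr
  obtain ⟨c, hc⟩ := exists_pow_eq_of_moments hr hz hw hm hcard
  -- The ratio is an (m+1)-st root of unity other than 1. Summing w j times these geometric sums
  -- isolates w i, while the moment conditions leave only the term k = 0, the total weight.
  have hgeom : ∀ j ∈ s, j ≠ i → ∑ k ∈ Finset.range (m + 1), (z j / z i) ^ k = 0 := by
    intro j hj hji
    have h1 : z j / z i ≠ 1 := fun h => hji (hinj hj hi ((div_eq_one_iff_eq (hz0 i hi)).1 h))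
    rw [geom_sum_eq h1, div_pow, hc j hj, hc i hi, div_self, sub_self, zero_div]
    rw [← hc i hi]
    exact pow_ne_zero _ (hz0 i hi)
  have h1 : ∑ j ∈ s, (w j : ℂ) * ∑ k ∈ Finset.range (m + 1), (z j / z i) ^ k =
      (m + 1) * w i := by
    rw [Finset.sum_eq_single_of_mem i hi fun j hj hji => by rw [hgeom j hj hji, mul_zero],
      div_self (hz0 i hi)]
    simp
    ring
  have h2 : ∑ j ∈ s, (w j : ℂ) * ∑ k ∈ Finset.range (m + 1), (z j / z i) ^ k =
      ∑ j ∈ s, (w j : ℂ) := by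
    simp only [Finset.mul_sum]
    rw [Finset.sum_comm, Finset.sum_range_succ', Finset.sum_eq_zero]
    · simp
    · intro k hk
      have := Finset.mem_range.1 hk
      have h := hm (k + 1) (by omega) (by omega)
      calc _ = (z i ^ (k + 1))⁻¹ * ∑ j ∈ s, (w j : ℂ) * z j ^ (k + 1) := by
            rw [Finset.mul_sum]
            refine Finset.sum_congr rfl fun j _ => ?_
            rw [div_pow]
            ring
        _ = 0 := by rw [h, mul_zero]
  rw [h1] at h2
  exact_mod_cast h2

end Circle
end

/-! ### An algebraic family of six-point planar 4-designs -/

noncomputable section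
open scoped ComplexConjugate Topology

/-- Six weighted points of the plane, symmetric in the real axis: `p`, `-q`, `-β ± s i` and
`d ± t i`, with the weights `A`, `B`, `C`, `D`. -/
structure Hexad where
  p : ℝ
  q : ℝ
  β : ℝ
  d : ℝ
  s : ℝ
  t : ℝ
  A : ℝ
  B : ℝ
  C : ℝ
  D : ℝ

namespace Hexad

/-- The points of a hexad. -/
def pt (H : Hexad) : Fin 6 → ℂ :=
  ![⟨H.p, 0⟩, ⟨-H.q, 0⟩, ⟨-H.β, H.s⟩, ⟨-H.β, -H.s⟩, ⟨H.d, H.t⟩, ⟨H.d, -H.t⟩]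

/-- The weights of a hexad. -/
def wt (H : Hexad) : Fin 6 → ℝ := ![H.A, H.B, H.C, H.C, H.D, H.D]

/-- The moments of a hexad up to degree four are those of a rotation-invariant measure. -/
structure IsBalanced (H : Hexad) : Prop where
  x1 : H.A * H.p - H.B * H.q - 2 * H.C * H.β + 2 * H.D * H.d = 0
  x2 : H.A * H.p ^ 2 + H.B * H.q ^ 2 + 2 * H.C * H.β ^ 2 + 2 * H.D * H.d ^ 2 =
    2 * H.C * H.s ^ 2 + 2 * H.D * H.t ^ 2
  x3 : H.A * H.p ^ 3 - H.B * H.q ^ 3 - 2 * H.C * H.β ^ 3 + 2 * H.D * H.d ^ 3 = 0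
  x1y2 : H.D * H.d * H.t ^ 2 - H.C * H.β * H.s ^ 2 = 0
  x4 : H.A * H.p ^ 4 + H.B * H.q ^ 4 + 2 * H.C * H.β ^ 4 + 2 * H.D * H.d ^ 4 =
    2 * H.C * H.s ^ 4 + 2 * H.D * H.t ^ 4
  x2y2 : H.C * H.s ^ 4 + H.D * H.t ^ 4 = 3 * (H.C * H.β ^ 2 * H.s ^ 2 + H.D * H.d ^ 2 * H.t ^ 2)

theorem IsBalanced.moment_eq_zero {H : Hexad} (hH : H.IsBalanced) (a b : ℕ) (hab : a + b ≤ 4)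
    (hba : b < a) : ∑ k, (H.wt k : ℂ) * (H.pt k ^ a * conj (H.pt k) ^ b) = 0 := by
  have ha : a ≤ 4 := by omega
  have hb : b ≤ 1 := by omega
  obtain ⟨h1, h2, h3, h4, h5, h6⟩ := hH
  rw [Fin.sum_univ_six]
  interval_cases a <;> interval_cases b <;> try omega
  all_goals
    simp only [wt, pt, Matrix.cons_val, Complex.ext_iff, pow_succ, pow_zero, one_mul, mul_one,
      Complex.add_re, Complex.add_im, Complex.mul_re, Complex.mul_im, Complex.ofReal_re,
      Complex.ofReal_im, Complex.conj_re, Complex.conj_im, Complex.zero_re, Complex.zero_im]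
    -- Imaginary parts cancel by the symmetry in the real axis.
    refine ⟨?_, by ring⟩
  · linear_combination h1
  · linear_combination h2
  · linear_combination h3 + 2 * h4
  · linear_combination h3 - 6 * h4
  · linear_combination h5
  · linear_combination h5 + 4 * h6

/-! A family of balanced hexads with total weight `m`, second moments `1` and mixed fourth moment
`h`, moved along `ρ = p q`. -/

/-- The square of `k = p - q`. -/
def radical (h m ρ : ℝ) : ℝ :=
  (8 * h ^ 2 * (1 - ρ * m) - 3 * h * (1 - ρ * m) * ρ + 3 * h * ρ - ρ ^ 2) / (2 * h)

def k (h m ρ : ℝ) : ℝ := √(radical h m ρ)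

/-- This is d - β. Since p and -q are the roots of x² - kx - ρ, the sum of w x² (x² - kx - ρ)
involves only the four points off the axis; requiring ∑ w x² = 1, ∑ w x³ = 0 and ∑ w x⁴ = 3h then
fixes kσ. -/
def σ (h m ρ : ℝ) : ℝ := (ρ - 3 * h + h * (1 - ρ * m)) / k h m ρ

/-- The slope in y² = 3h + g x, imposed on the points off the axis; with dβ = h it gives ∑ w y⁴ =
3h. -/
def g (h m ρ : ℝ) : ℝ := (3 * h * (1 - ρ * m) - h + ρ) / k h m ρ

def pFun (h m ρ : ℝ) : ℝ := (k h m ρ + √(k h m ρ ^ 2 + 4 * ρ)) / 2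

def qFun (h m ρ : ℝ) : ℝ := (-k h m ρ + √(k h m ρ ^ 2 + 4 * ρ)) / 2

def dFun (h m ρ : ℝ) : ℝ := (σ h m ρ + √(σ h m ρ ^ 2 + 4 * h)) / 2

def βFun (h m ρ : ℝ) : ℝ := (-σ h m ρ + √(σ h m ρ ^ 2 + 4 * h)) / 2

def uFun (h m ρ : ℝ) : ℝ := 3 * h - g h m ρ * βFun h m ρ

def vFun (h m ρ : ℝ) : ℝ := 3 * h + g h m ρ * dFun h m ρ

/-- The numbers 2Cu and 2Dv are the masses at -β and d of the measure y² w: total mass 1 and mean 0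
determine them, and its second moment is then dβ = h. -/
def cFun (h m ρ : ℝ) : ℝ := dFun h m ρ / (2 * ((dFun h m ρ + βFun h m ρ) * uFun h m ρ))

def eFun (h m ρ : ℝ) : ℝ := βFun h m ρ / (2 * ((dFun h m ρ + βFun h m ρ) * vFun h m ρ))

/-- The weights A and B solve the two linear equations "total weight m" and "first moment zero". -/
def aFun (h m ρ : ℝ) : ℝ :=
  (qFun h m ρ * (m - 2 * cFun h m ρ - 2 * eFun h m ρ) + 2 * cFun h m ρ * βFun h m ρ -
    2 * eFun h m ρ * dFun h m ρ) / (pFun h m ρ + qFun h m ρ)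

def bFun (h m ρ : ℝ) : ℝ :=
  (pFun h m ρ * (m - 2 * cFun h m ρ - 2 * eFun h m ρ) - 2 * cFun h m ρ * βFun h m ρ +
    2 * eFun h m ρ * dFun h m ρ) / (pFun h m ρ + qFun h m ρ)

/-- The hexad with parameters `h`, `m`, `ρ`. -/
def family (h m ρ : ℝ) : Hexad where
  p := pFun h m ρ
  q := qFun h m ρ
  β := βFun h m ρ
  d := dFun h m ρ
  s := √(uFun h m ρ)
  t := √(vFun h m ρ)
  A := aFun h m ρ
  B := bFun h m ρ
  C := cFun h m ρ
  D := eFun h m ρ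

section algebra

variable {h m ρ : ℝ}

theorem dFun_mul_βFun (hh : 0 < h) : dFun h m ρ * βFun h m ρ = h := by
  rw [dFun, βFun]
  have := Real.sq_sqrt (show 0 ≤ σ h m ρ ^ 2 + 4 * h by positivity)
  linear_combination this / 4

theorem dFun_add_βFun (hh : 0 < h) : 0 < dFun h m ρ + βFun h m ρ := by
  rw [dFun, βFun]
  have := Real.sqrt_pos.2 (show 0 < σ h m ρ ^ 2 + 4 * h by positivity)
  linarith

theorem pFun_mul_qFun (hk : 0 < k h m ρ ^ 2 + 4 * ρ) : pFun h m ρ * qFun h m ρ = ρ := by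
  rw [pFun, qFun]
  linear_combination (Real.sq_sqrt hk.le) / 4

theorem pFun_add_qFun (hk : 0 < k h m ρ ^ 2 + 4 * ρ) : 0 < pFun h m ρ + qFun h m ρ := by
  rw [pFun, qFun]
  have := Real.sqrt_pos.2 hk
  linarith

/-- Multiplying x² - kx - ρ by 1, x, x² and summing with the weights removes the axis points. The
moments of x of degrees 2, 3, 4 become conditions on C and D, which must agree with the values
already fixed by the measure y² w; the formulas for σ, g and k² express this compatibility. -/
theorem family_isBalanced (hh : 0 < h) (hr : 0 < radical h m ρ) (hk : 0 < k h m ρ ^ 2 + 4 * ρ)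
    (hu : 0 < uFun h m ρ) (hv : 0 < vFun h m ρ) : (family h m ρ).IsBalanced := by
  have hk0 : 0 < k h m ρ := Real.sqrt_pos.2 hr
  have e1 : k h m ρ * σ h m ρ = ρ - 3 * h + h * (1 - ρ * m) := by rw [σ]; field_simp
  have e2 : k h m ρ * g h m ρ = 3 * h * (1 - ρ * m) - h + ρ := by rw [g]; field_simp
  have e3 : 2 * h * k h m ρ ^ 2 =
      8 * h ^ 2 * (1 - ρ * m) - 3 * h * (1 - ρ * m) * ρ + 3 * h * ρ - ρ ^ 2 := by
    rw [k, Real.sq_sqrt hr.le, radical]; field_simp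
  have e4 : dFun h m ρ * βFun h m ρ = h := dFun_mul_βFun hh
  have e5 : dFun h m ρ - βFun h m ρ = σ h m ρ := by rw [dFun, βFun]; ring
  have e6 := dFun_add_βFun (m := m) (ρ := ρ) hh
  have e7 := pFun_mul_qFun hk
  have e8 : pFun h m ρ - qFun h m ρ = k h m ρ := by rw [pFun, qFun]; ring
  have e9 := pFun_add_qFun hk
  have e10 : uFun h m ρ = 3 * h - g h m ρ * βFun h m ρ := rfl
  have e11 : vFun h m ρ = 3 * h + g h m ρ * dFun h m ρ := rfl
  have e12 : 2 * cFun h m ρ * uFun h m ρ * (dFun h m ρ + βFun h m ρ) = dFun h m ρ := by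
    rw [cFun]; field_simp
  have e13 : 2 * eFun h m ρ * vFun h m ρ * (dFun h m ρ + βFun h m ρ) = βFun h m ρ := by
    rw [eFun]; field_simp
  have e14 : aFun h m ρ + bFun h m ρ = m - 2 * cFun h m ρ - 2 * eFun h m ρ := by
    rw [aFun, bFun]; field_simp; ring
  have e15 : aFun h m ρ * pFun h m ρ - bFun h m ρ * qFun h m ρ =
      2 * cFun h m ρ * βFun h m ρ - 2 * eFun h m ρ * dFun h m ρ := by
    rw [aFun, bFun]; field_simp; ring
  have hs : √(uFun h m ρ) ^ 2 = uFun h m ρ := Real.sq_sqrt hu.le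
  have ht : √(vFun h m ρ) ^ 2 = vFun h m ρ := Real.sq_sqrt hv.le
  generalize k h m ρ = k at *
  generalize σ h m ρ = σ at *
  generalize g h m ρ = g at *
  -- Compatibility of C reads d(β² + kβ - ρ) = u(d(1 - ρm) + k). Using dβ = h and β = d - σ it
  -- becomes linear in d: `e2` is the coefficient of d and this is the constant term. Multiplied by
  -- k it becomes the formula `e3` for k².
  have key : (2 * k + σ) * h = g * (h * (1 - ρ * m) - σ * k) := by
    apply mul_left_cancel₀ hk0.ne'
    linear_combination (-h * (1 - ρ * m) + σ * k) * e2 + e3 + (3 * h * (1 - ρ * m) + ρ) * e1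
  rw [family]
  generalize pFun h m ρ = p at *
  generalize qFun h m ρ = q at *
  generalize dFun h m ρ = d at *
  generalize βFun h m ρ = β at *
  generalize aFun h m ρ = A at *
  generalize bFun h m ρ = B at *
  generalize cFun h m ρ = C at *
  generalize eFun h m ρ = D at *
  generalize uFun h m ρ = u at *
  generalize vFun h m ρ = v at *
  have hd : d ≠ 0 := by rintro rfl; linarith
  have hβ : β ≠ 0 := by rintro rfl; linarith
  have f1 : 2 * C * (β ^ 2 + k * β - ρ) * (d + β) = d * (1 - ρ * m) + k := by
    have : d * (β ^ 2 + k * β - ρ) = u * (d * (1 - ρ * m) + k) := by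
      linear_combination (β + k + g * (1 - ρ * m)) * e4 - (h + g * k) * e5 + d * e2
        - (d * (1 - ρ * m) + k) * e10 - key
    apply mul_left_cancel₀ hd
    linear_combination 2 * C * (d + β) * this + (d * (1 - ρ * m) + k) * e12
  have f2 : 2 * D * (d ^ 2 - k * d - ρ) * (d + β) = β * (1 - ρ * m) - k := by
    have : β * (d ^ 2 - k * d - ρ) = v * (β * (1 - ρ * m) - k) := by
      linear_combination (d - k - g * (1 - ρ * m)) * e4 + (h + g * k) * e5 + β * e2
        - (β * (1 - ρ * m) - k) * e11 + key
    apply mul_left_cancel₀ hβ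
    linear_combination 2 * D * (d + β) * this + (β * (1 - ρ * m) - k) * e13
  have f3 : d * u + β * v = 3 * h * (d + β) := by
    linear_combination d * e10 + β * e11
  have hp : p ^ 2 = k * p + ρ := by linear_combination p * e8 + e7
  have hq : q ^ 2 = -(k * q) + ρ := by linear_combination -q * e8 + e7
  have y2 : 2 * C * u + 2 * D * v = 1 := by
    apply mul_right_cancel₀ e6.ne'
    linear_combination e12 + e13
  have y4 : 2 * C * u ^ 2 + 2 * D * v ^ 2 = 3 * h := by
    apply mul_right_cancel₀ e6.ne'
    linear_combination u * e12 + v * e13 + f3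
  have x2 : A * p ^ 2 + B * q ^ 2 + 2 * C * β ^ 2 + 2 * D * d ^ 2 = 1 := by
    apply mul_right_cancel₀ e6.ne'
    linear_combination (d + β) * (A * hp + B * hq + k * e15 + ρ * e14) + f1 + f2
  have x3 : A * p ^ 3 - B * q ^ 3 - 2 * C * β ^ 3 + 2 * D * d ^ 3 = 0 := by
    apply mul_right_cancel₀ e6.ne'
    linear_combination (d + β) * (A * p * hp - B * q * hq + k * x2 + ρ * e15) - β * f1 + d * f2
  have hs4 : √u ^ 4 = u ^ 2 := by rw [show √u ^ 4 = (√u ^ 2) ^ 2 by ring, hs]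
  have ht4 : √v ^ 4 = v ^ 2 := by rw [show √v ^ 4 = (√v ^ 2) ^ 2 by ring, ht]
  refine ⟨by linear_combination e15, ?_, x3, ?_, ?_, ?_⟩
  · simp only [hs, ht]
    linear_combination x2 - y2
  · simp only [hs, ht]
    apply mul_right_cancel₀ e6.ne'
    linear_combination d / 2 * e13 - β / 2 * e12
  · simp only [hs4, ht4]
    apply mul_right_cancel₀ e6.ne'
    linear_combination (d + β) * (A * p ^ 2 * hp + B * q ^ 2 * hq + k * x3 + ρ * x2 - y4)
      + β ^ 2 * f1 + d ^ 2 * f2 + (1 - ρ * m) * (d + β) * e4 - (d + β) * e1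
      - k * (d + β) * e5
  · simp only [hs4, ht4, hs, ht]
    apply mul_right_cancel₀ e6.ne'
    linear_combination (d + β) / 2 * y4 - 3 / 2 * (β ^ 2 * e12 + d ^ 2 * e13)
      - 3 / 2 * (d + β) * e4

end algebra
end Hexad
end

/-! ### Continuity of the family, its base points, and loss of equal norms -/

noncomputable section
open scoped ComplexConjugate Topology

namespace Hexad

theorem norm_eq_norm_iff (z w : ℂ) :
    ‖z‖ = ‖w‖ ↔ z.re ^ 2 + z.im ^ 2 = w.re ^ 2 + w.im ^ 2 := by
  rw [← sq_eq_sq₀ (norm_nonneg z) (norm_nonneg w), Complex.sq_norm, Complex.sq_norm,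
    Complex.normSq_apply, Complex.normSq_apply]
  ring_nf

/-- The nondegeneracy conditions under which `family h m` is defined and continuous at `ρ`. -/
structure Regular (h m ρ : ℝ) : Prop where
  h_pos : 0 < h
  radical_pos : 0 < radical h m ρ
  disc_pos : 0 < k h m ρ ^ 2 + 4 * ρ
  u_pos : 0 < uFun h m ρ
  v_pos : 0 < vFun h m ρ

variable {h m ρ : ℝ}

theorem Regular.k_ne (H : Regular h m ρ) : k h m ρ ≠ 0 := (Real.sqrt_pos.2 H.radical_pos).ne'

theorem continuous_radical : Continuous (radical h m) := by unfold radical; fun_prop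

theorem continuous_k : Continuous (k h m) := continuous_radical.sqrt

theorem Regular.continuousAt_σ (H : Regular h m ρ) : ContinuousAt (σ h m) ρ := by
  unfold σ
  exact ContinuousAt.div (by fun_prop) continuous_k.continuousAt H.k_ne

theorem Regular.continuousAt_g (H : Regular h m ρ) : ContinuousAt (g h m) ρ := by
  unfold g
  exact ContinuousAt.div (by fun_prop) continuous_k.continuousAt H.k_ne

theorem continuous_pFun : Continuous (pFun h m) := by
  have := continuous_k (h := h) (m := m)
  unfold pFun
  fun_prop

theorem continuous_qFun : Continuous (qFun h m) := by
  have := continuous_k (h := h) (m := m)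
  unfold qFun
  fun_prop

theorem Regular.continuousAt_dFun (H : Regular h m ρ) : ContinuousAt (dFun h m) ρ := by
  have := H.continuousAt_σ
  unfold dFun
  fun_prop

theorem Regular.continuousAt_βFun (H : Regular h m ρ) : ContinuousAt (βFun h m) ρ := by
  have := H.continuousAt_σ
  unfold βFun
  fun_prop

theorem Regular.continuousAt_uFun (H : Regular h m ρ) : ContinuousAt (uFun h m) ρ := by
  have := H.continuousAt_g
  have := H.continuousAt_βFun
  unfold uFun
  fun_prop

theorem Regular.continuousAt_vFun (H : Regular h m ρ) : ContinuousAt (vFun h m) ρ := by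
  have := H.continuousAt_g
  have := H.continuousAt_dFun
  unfold vFun
  fun_prop

theorem Regular.continuousAt_cFun (H : Regular h m ρ) : ContinuousAt (cFun h m) ρ := by
  have := H.continuousAt_uFun
  have := H.continuousAt_βFun
  have h1 := H.continuousAt_dFun
  unfold cFun
  exact h1.div (by fun_prop)
    (mul_pos two_pos (mul_pos (dFun_add_βFun H.h_pos) H.u_pos)).ne'

theorem Regular.continuousAt_eFun (H : Regular h m ρ) : ContinuousAt (eFun h m) ρ := by
  have := H.continuousAt_vFun
  have h1 := H.continuousAt_βFun
  have := H.continuousAt_dFun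
  unfold eFun
  exact h1.div (by fun_prop)
    (mul_pos two_pos (mul_pos (dFun_add_βFun H.h_pos) H.v_pos)).ne'

theorem Regular.continuousAt_aFun (H : Regular h m ρ) : ContinuousAt (aFun h m) ρ := by
  have := H.continuousAt_cFun
  have := H.continuousAt_eFun
  have := H.continuousAt_βFun
  have := H.continuousAt_dFun
  have := continuous_pFun (h := h) (m := m)
  have := continuous_qFun (h := h) (m := m)
  unfold aFun
  exact ContinuousAt.div (by fun_prop) (by fun_prop) (pFun_add_qFun H.disc_pos).ne'

theorem Regular.continuousAt_bFun (H : Regular h m ρ) : ContinuousAt (bFun h m) ρ := by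
  have := H.continuousAt_cFun
  have := H.continuousAt_eFun
  have := H.continuousAt_βFun
  have := H.continuousAt_dFun
  have := continuous_pFun (h := h) (m := m)
  have := continuous_qFun (h := h) (m := m)
  unfold bFun
  exact ContinuousAt.div (by fun_prop) (by fun_prop) (pFun_add_qFun H.disc_pos).ne'

theorem continuousAt_mk {f g : ℝ → ℝ} {x : ℝ} (hf : ContinuousAt f x) (hg : ContinuousAt g x) :
    ContinuousAt (fun y => (⟨f y, g y⟩ : ℂ)) x :=
  Complex.equivRealProdCLM.symm.continuous.continuousAt.comp (hf.prodMk hg)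

theorem Regular.continuousAt_pt (H : Regular h m ρ) (i : Fin 6) :
    ContinuousAt (fun ρ => (family h m ρ).pt i) ρ := by
  have h1 := H.continuousAt_uFun.sqrt
  have h2 := H.continuousAt_vFun.sqrt
  have h3 := H.continuousAt_βFun
  have h4 := H.continuousAt_dFun
  have h5 := (continuous_pFun (h := h) (m := m)).continuousAt (x := ρ)
  have h6 := (continuous_qFun (h := h) (m := m)).continuousAt (x := ρ)
  fin_cases i
  · exact continuousAt_mk h5 continuousAt_const
  · exact continuousAt_mk h6.neg continuousAt_const
  · exact continuousAt_mk h3.neg h1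
  · exact continuousAt_mk h3.neg h1.neg
  · exact continuousAt_mk h4 h2
  · exact continuousAt_mk h4 h2.neg

theorem Regular.continuousAt_wt (H : Regular h m ρ) (i : Fin 6) :
    ContinuousAt (fun ρ => (family h m ρ).wt i) ρ := by
  fin_cases i
  · exact H.continuousAt_aFun
  · exact H.continuousAt_bFun
  · exact H.continuousAt_cFun
  · exact H.continuousAt_cFun
  · exact H.continuousAt_eFun
  · exact H.continuousAt_eFun

theorem Regular.eventually (H : Regular h m ρ) : ∀ᶠ ρ' in 𝓝 ρ, Regular h m ρ' := by
  have hk : Continuous fun ρ => k h m ρ ^ 2 + 4 * ρ := by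
    have := continuous_k (h := h) (m := m)
    fun_prop
  filter_upwards [continuous_radical.continuousAt.eventually (lt_mem_nhds H.radical_pos),
    hk.continuousAt.eventually (lt_mem_nhds H.disc_pos),
    H.continuousAt_uFun.eventually (lt_mem_nhds H.u_pos),
    H.continuousAt_vFun.eventually (lt_mem_nhds H.v_pos)] with ρ' h1 h2 h3 h4
  exact ⟨H.h_pos, h1, h2, h3, h4⟩

theorem Regular.isBalanced (H : Regular h m ρ) : (family h m ρ).IsBalanced :=
  family_isBalanced H.h_pos H.radical_pos H.disc_pos H.u_pos H.v_pos

theorem Regular.isStronglyNonRigid (H : Regular h m ρ) {N : ℕ} (X : WeightedPoints 2 N)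
    (hX : X.IsEuclideanDesign 4) (e : Fin N ≃ Fin 6) (ζ : ℂ) (hζ : ζ ≠ 0) (c : ℝ)
    (hZ0 : ∀ i, planeIsometry.symm (X.pt i) = ζ * (family h m ρ).pt (e i))
    (hW0 : ∀ i, X.wt i = c * (family h m ρ).wt (e i))
    (hnorm : ∀ᶠ ρ' in 𝓝[≠] ρ, ∃ i j, ‖(family h m ρ).pt i‖ = ‖(family h m ρ).pt j‖ ∧
      ‖(family h m ρ').pt i‖ ≠ ‖(family h m ρ').pt j‖) : X.IsStronglyNonRigid 4 := by
  refine X.isStronglyNonRigid_of_planar_curve hX e ζ hζ c (fun ρ => (family h m ρ).pt)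
    (fun ρ => (family h m ρ).wt) ρ H.continuousAt_pt H.continuousAt_wt hZ0 hW0 ?_ hnorm
  filter_upwards [H.eventually.filter_mono nhdsWithin_le_nhds] with ρ' H' a b hab hba
  exact H'.isBalanced.moment_eq_zero a b hab hba

/-- A balanced hexad that lies on two circles as two triangles consists of two regular triangles. -/
theorem IsBalanced.triangles {H : Hexad} (hH : H.IsBalanced) (hpβ : H.p + H.β ≠ 0)
    (hqd : H.q + H.d ≠ 0) (hC : H.C ≠ 0) (hD : H.D ≠ 0) (hpq : H.p ^ 2 ≠ H.q ^ 2)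
    (h1 : H.p ^ 2 = H.β ^ 2 + H.s ^ 2) (h2 : H.q ^ 2 = H.d ^ 2 + H.t ^ 2) :
    H.p = 2 * H.β ∧ H.q = 2 * H.d := by
  obtain ⟨x1, x2, x3, x1y2, x4, x2y2⟩ := hH
  have hpq' : H.p ^ 2 - H.q ^ 2 ≠ 0 := sub_ne_zero.2 hpq
  -- The combination x3 + 2 x1y2 is ∑ w x |z|². Subtracting q² ∑ w x removes the triangle of radius
  -- |q| and leaves the first moment of the other one.
  have e1 : H.A * H.p = 2 * H.C * H.β := by
    apply mul_left_cancel₀ hpq'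
    linear_combination x3 + 2 * x1y2 - H.q ^ 2 * x1 - 2 * H.C * H.β * h1 + 2 * H.D * H.d * h2
  have e2 : H.B * H.q = 2 * H.D * H.d := by linear_combination e1 - x1
  -- The same elimination for x² - y², since x⁴ - y⁴ = (x² - y²)|z|².
  have e3 : H.A * H.p ^ 2 + 2 * H.C * (H.β ^ 2 - H.s ^ 2) = 0 := by
    apply mul_left_cancel₀ hpq'
    linear_combination x4 - H.q ^ 2 * x2 + 2 * H.C * (H.β ^ 2 - H.s ^ 2) * h1 +
      2 * H.D * (H.d ^ 2 - H.t ^ 2) * h2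
  have e4 : H.B * H.q ^ 2 + 2 * H.D * (H.d ^ 2 - H.t ^ 2) = 0 := by
    linear_combination x2 - e3
  constructor
  -- Once s² is eliminated, the two moment equations give 2C(p + β)(p - 2β) = 0.
  · apply mul_left_cancel₀ hpβ
    apply mul_left_cancel₀ (mul_ne_zero two_ne_zero hC)
    linear_combination H.p * e1 - e3 + 2 * H.C * h1
  · apply mul_left_cancel₀ hqd
    apply mul_left_cancel₀ (mul_ne_zero two_ne_zero hD)
    linear_combination H.q * e2 - e4 + 2 * H.D * h2

/-- In a balanced hexad of which five points lie on a circle, the sixth is the centre. -/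
theorem IsBalanced.eq_zero_of_pentagon {H : Hexad} (hH : H.IsBalanced) (hB : H.B ≠ 0)
    (hpq : H.p ^ 2 ≠ H.q ^ 2)
    (h1 : H.p ^ 2 = H.β ^ 2 + H.s ^ 2) (h2 : H.p ^ 2 = H.d ^ 2 + H.t ^ 2) : H.q = 0 := by
  obtain ⟨x1, x2, x3, x1y2, x4, x2y2⟩ := hH
  -- In ∑ w x (|z|² - p²) = 0 only the point -q contributes.
  apply mul_left_cancel₀ hB
  apply mul_left_cancel₀ (sub_ne_zero.2 hpq)
  linear_combination x3 + 2 * x1y2 - H.p ^ 2 * x1 - 2 * H.C * H.β * h1 + 2 * H.D * H.d * h2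

section base

variable {x : ℝ}

theorem radical_triangles (hx : 0 < x) :
    radical (x / 4) (2 * (1 - x + x ^ 2) / x ^ 2) x = (1 - x) ^ 2 := by
  rw [radical]; field_simp; ring

theorem k_triangles (hx : 0 < x) (hx1 : x < 1) :
    k (x / 4) (2 * (1 - x + x ^ 2) / x ^ 2) x = 1 - x := by
  rw [k, radical_triangles hx, Real.sqrt_sq (by linarith)]

theorem σ_triangles (hx : 0 < x) (hx1 : x < 1) :
    σ (x / 4) (2 * (1 - x + x ^ 2) / x ^ 2) x = -(1 - x) / 2 := by
  have : 1 - x ≠ 0 := by linarith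
  rw [σ, k_triangles hx hx1]; field_simp; ring

theorem g_triangles (hx : 0 < x) (hx1 : x < 1) :
    g (x / 4) (2 * (1 - x + x ^ 2) / x ^ 2) x = -(3 / 2 * (1 - x)) := by
  have : 1 - x ≠ 0 := by linarith
  rw [g, k_triangles hx hx1]; field_simp; ring

/-- The base parameters are read off from the triangles 1, ω, ω² and -x, -xω, -xω²: ρ = 1·x, h = dβ
= (x/2)(1/2), and m is the total weight when the second moments are scaled to 1. -/
theorem family_triangles (hx : 0 < x) (hx1 : x < 1) :
    Regular (x / 4) (2 * (1 - x + x ^ 2) / x ^ 2) x ∧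
    family (x / 4) (2 * (1 - x + x ^ 2) / x ^ 2) x =
      ⟨1, x, 1 / 2, x / 2, √3 / 2, x * √3 / 2, 2 * x / (3 * (1 + x)), 2 / (3 * x ^ 2 * (1 + x)),
        2 * x / (3 * (1 + x)), 2 / (3 * x ^ 2 * (1 + x))⟩ := by
  have hk := k_triangles hx hx1
  have hσ := σ_triangles hx hx1
  have hg := g_triangles hx hx1
  have hr := radical_triangles hx
  generalize hm : 2 * (1 - x + x ^ 2) / x ^ 2 = m at *
  have hd1 : k (x / 4) m x ^ 2 + 4 * x = (1 + x) ^ 2 := by rw [hk]; ring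
  have hp : pFun (x / 4) m x = 1 := by
    rw [pFun, hd1, Real.sqrt_sq (by linarith), hk]; ring
  have hq : qFun (x / 4) m x = x := by
    rw [qFun, hd1, Real.sqrt_sq (by linarith), hk]; ring
  have hd2 : σ (x / 4) m x ^ 2 + 4 * (x / 4) = ((1 + x) / 2) ^ 2 := by rw [hσ]; ring
  have hd : dFun (x / 4) m x = x / 2 := by
    rw [dFun, hd2, Real.sqrt_sq (by linarith), hσ]; ring
  have hβ : βFun (x / 4) m x = 1 / 2 := by
    rw [βFun, hd2, Real.sqrt_sq (by linarith), hσ]; ring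
  have hu : uFun (x / 4) m x = 3 / 4 := by rw [uFun, hg, hβ]; ring
  have hv : vFun (x / 4) m x = x ^ 2 * (3 / 4) := by rw [vFun, hg, hd]; ring
  have hx2 : 1 + x ≠ 0 := by linarith
  have hx3 : x / 2 + 1 / 2 ≠ 0 := by linarith
  have hc : cFun (x / 4) m x = 2 * x / (3 * (1 + x)) := by
    rw [cFun, hd, hβ, hu, show x / 2 + 1 / 2 = (1 + x) / 2 by ring]; field_simp; ring
  have he : eFun (x / 4) m x = 2 / (3 * x ^ 2 * (1 + x)) := by
    rw [eFun, hd, hβ, hv, show x / 2 + 1 / 2 = (1 + x) / 2 by ring]; field_simp; ring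
  have ha : aFun (x / 4) m x = 2 * x / (3 * (1 + x)) := by
    rw [aFun, hp, hq, hc, he, hd, hβ, ← hm]; field_simp; ring
  have hb : bFun (x / 4) m x = 2 / (3 * x ^ 2 * (1 + x)) := by
    rw [bFun, hp, hq, hc, he, hd, hβ, ← hm]; field_simp; ring
  have hs3 : √(3 / 4 : ℝ) = √3 / 2 := by
    rw [Real.sqrt_div (by norm_num), show (4 : ℝ) = 2 ^ 2 by norm_num,
      Real.sqrt_sq (by norm_num)]
  refine ⟨⟨by linarith, ?_, ?_, ?_, ?_⟩, ?_⟩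
  · rw [hr]; have : 1 - x ≠ 0 := by linarith
    positivity
  · rw [hd1]; positivity
  · rw [hu]; norm_num
  · rw [hv]; positivity
  · rw [family, hp, hq, hd, hβ, ha, hb, hc, he, hu, hv, Real.sqrt_mul (sq_nonneg x),
      Real.sqrt_sq hx.le, hs3]
    congr 1
    ring

theorem radical_pentagon (m : ℝ) : radical (1 / 4) m 0 = 1 := by rw [radical]; norm_num

theorem k_pentagon (m : ℝ) : k (1 / 4) m 0 = 1 := by rw [k, radical_pentagon, Real.sqrt_one]

/-- Here q = 0, hence ρ = 0. The centre affects no moment except the total weight, so m stays free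
and the centre carries m - 2. -/
theorem family_pentagon (m : ℝ) :
    Regular (1 / 4) m 0 ∧
    family (1 / 4) m 0 =
      ⟨1, 0, (√5 + 1) / 4, (√5 - 1) / 4, √(1 - ((√5 + 1) / 4) ^ 2), √(1 - ((√5 - 1) / 4) ^ 2),
        2 / 5, m - 2, 2 / 5, 2 / 5⟩ := by
  have hk := k_pentagon m
  have hσ : σ (1 / 4) m 0 = -(1 / 2) := by rw [σ, hk]; norm_num
  have hg : g (1 / 4) m 0 = 1 / 2 := by rw [g, hk]; norm_num
  have h5 : √5 ^ 2 = (5 : ℝ) := Real.sq_sqrt (by norm_num)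
  have h5pos : 0 < √(5 : ℝ) := Real.sqrt_pos.2 (by norm_num)
  have h5lt : √(5 : ℝ) < 3 := by nlinarith
  have hp : pFun (1 / 4) m 0 = 1 := by rw [pFun, hk]; norm_num
  have hq : qFun (1 / 4) m 0 = 0 := by rw [qFun, hk]; norm_num
  have hd2 : √(σ (1 / 4) m 0 ^ 2 + 4 * (1 / 4)) = √5 / 2 := by
    rw [hσ, show (-(1 / 2) : ℝ) ^ 2 + 4 * (1 / 4) = 5 / 2 ^ 2 by norm_num,
      Real.sqrt_div (by norm_num), Real.sqrt_sq (by norm_num)]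
  have hd : dFun (1 / 4) m 0 = (√5 - 1) / 4 := by rw [dFun, hd2, hσ]; ring
  have hβ : βFun (1 / 4) m 0 = (√5 + 1) / 4 := by rw [βFun, hd2, hσ]; ring
  have hu' : uFun (1 / 4) m 0 = (5 - √5) / 8 := by rw [uFun, hg, hβ]; ring
  have hv' : vFun (1 / 4) m 0 = (5 + √5) / 8 := by rw [vFun, hg, hd]; ring
  have hu : uFun (1 / 4) m 0 = 1 - ((√5 + 1) / 4) ^ 2 := by
    rw [hu']; linear_combination h5 / 16
  have hv : vFun (1 / 4) m 0 = 1 - ((√5 - 1) / 4) ^ 2 := by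
    rw [hv']; linear_combination h5 / 16
  have hc : cFun (1 / 4) m 0 = 2 / 5 := by
    have : 5 - √5 ≠ 0 := by linarith
    rw [cFun, hd, hβ, hu', show (√5 - 1) / 4 + (√5 + 1) / 4 = √5 / 2 by ring]
    field_simp
    linear_combination 8 * h5
  have he : eFun (1 / 4) m 0 = 2 / 5 := by
    rw [eFun, hd, hβ, hv', show (√5 - 1) / 4 + (√5 + 1) / 4 = √5 / 2 by ring]
    field_simp
    linear_combination -8 * h5
  have ha : aFun (1 / 4) m 0 = 2 / 5 := by
    rw [aFun, hp, hq, hc, he, hd, hβ]; ring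
  have hb : bFun (1 / 4) m 0 = m - 2 := by
    rw [bFun, hp, hq, hc, he, hd, hβ]; ring
  refine ⟨⟨by norm_num, ?_, ?_, ?_, ?_⟩, ?_⟩
  · rw [radical_pentagon]; norm_num
  · rw [hk]; norm_num
  · rw [hu']; linarith
  · rw [hv']; linarith
  · rw [family, hp, hq, hd, hβ, ha, hb, hc, he, hu, hv]

end base

theorem norm_pt_two_eq_iff (H : Hexad) : ‖H.pt 0‖ = ‖H.pt 2‖ ↔ H.p ^ 2 = H.β ^ 2 + H.s ^ 2 := by
  rw [norm_eq_norm_iff]; simp [pt]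

theorem norm_pt_four_eq_iff (H : Hexad) : ‖H.pt 0‖ = ‖H.pt 4‖ ↔ H.p ^ 2 = H.d ^ 2 + H.t ^ 2 := by
  rw [norm_eq_norm_iff]; simp [pt]

theorem norm_pt_one_four_eq_iff (H : Hexad) :
    ‖H.pt 1‖ = ‖H.pt 4‖ ↔ H.q ^ 2 = H.d ^ 2 + H.t ^ 2 := by
  rw [norm_eq_norm_iff]; simp [pt]

/-- If the equalities of norms persisted, both triangles would remain regular, so p = 2β, q = 2d and
ρ = pq = 4dβ = 4h = x, the base parameter. -/
theorem isStronglyNonRigid_of_triangles {x : ℝ} (hx : 0 < x) (hx1 : x < 1) {N : ℕ}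
    (X : WeightedPoints 2 N) (hX : X.IsEuclideanDesign 4) (e : Fin N ≃ Fin 6) (ζ : ℂ) (hζ : ζ ≠ 0)
    (c : ℝ) (H : Hexad) (hH : H = ⟨1, x, 1 / 2, x / 2, √3 / 2, x * √3 / 2, 2 * x / (3 * (1 + x)),
      2 / (3 * x ^ 2 * (1 + x)), 2 * x / (3 * (1 + x)), 2 / (3 * x ^ 2 * (1 + x))⟩)
    (hZ0 : ∀ i, planeIsometry.symm (X.pt i) = ζ * H.pt (e i))
    (hW0 : ∀ i, X.wt i = c * H.wt (e i)) : X.IsStronglyNonRigid 4 := by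
  obtain ⟨hreg, hfam⟩ := family_triangles hx hx1
  refine hreg.isStronglyNonRigid X hX e ζ hζ c (by rwa [hfam, ← hH]) (by rwa [hfam, ← hH]) ?_
  generalize hm : 2 * (1 - x + x ^ 2) / x ^ 2 = m at *
  have h3 : √3 ^ 2 = (3 : ℝ) := Real.sq_sqrt (by norm_num)
  have n1 : ‖(family (x / 4) m x).pt 0‖ = ‖(family (x / 4) m x).pt 2‖ := by
    rw [norm_pt_two_eq_iff, hfam]; linear_combination -h3 / 4
  have n2 : ‖(family (x / 4) m x).pt 1‖ = ‖(family (x / 4) m x).pt 4‖ := by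
    rw [norm_pt_one_four_eq_iff, hfam]; linear_combination -x ^ 2 * h3 / 4
  have cp := (continuous_pFun (h := x / 4) (m := m)).continuousAt (x := x)
  have cq := (continuous_qFun (h := x / 4) (m := m)).continuousAt (x := x)
  have hp : pFun (x / 4) m x = 1 := congrArg Hexad.p hfam
  have hq : qFun (x / 4) m x = x := congrArg Hexad.q hfam
  have hβ : βFun (x / 4) m x = 1 / 2 := congrArg Hexad.β hfam
  have hd : dFun (x / 4) m x = x / 2 := congrArg Hexad.d hfam
  have hC : cFun (x / 4) m x = 2 * x / (3 * (1 + x)) := congrArg Hexad.C hfam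
  have hD : eFun (x / 4) m x = 2 / (3 * x ^ 2 * (1 + x)) := congrArg Hexad.D hfam
  have ev1 := (cp.add hreg.continuousAt_βFun).eventually_ne (y := 0)
    (by rw [Pi.add_apply, hp, hβ]; norm_num)
  have ev2 := (cq.add hreg.continuousAt_dFun).eventually_ne (y := 0)
    (by rw [Pi.add_apply, hq, hd]; positivity)
  have ev3 := hreg.continuousAt_cFun.eventually_ne (y := 0) (by rw [hC]; positivity)
  have ev4 := hreg.continuousAt_eFun.eventually_ne (y := 0) (by rw [hD]; positivity)
  have ev5 := ((cp.pow 2).sub (cq.pow 2)).eventually_ne (y := 0)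
    (by rw [Pi.sub_apply, Pi.pow_apply, Pi.pow_apply, hp, hq]; nlinarith)
  filter_upwards [(hreg.eventually.and (ev1.and (ev2.and (ev3.and (ev4.and ev5))))).filter_mono
    nhdsWithin_le_nhds, self_mem_nhdsWithin] with ρ ⟨H', h1, h2, h3, h4, h5⟩ hne
  by_contra hcon
  push Not at hcon
  have m1 := (norm_pt_two_eq_iff _).1 (hcon 0 2 n1)
  have m2 := (norm_pt_one_four_eq_iff _).1 (hcon 1 4 n2)
  obtain ⟨e1, e2⟩ := H'.isBalanced.triangles h1 h2 h3 h4 (sub_ne_zero.1 h5) m1 m2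
  have e3 := pFun_mul_qFun H'.disc_pos
  have e4 := dFun_mul_βFun (h := x / 4) (m := m) (ρ := ρ) H'.h_pos
  apply hne
  change pFun (x / 4) m ρ = 2 * βFun (x / 4) m ρ at e1
  change qFun (x / 4) m ρ = 2 * dFun (x / 4) m ρ at e2
  rw [Set.mem_singleton_iff, ← e3, e1, e2]
  linear_combination 4 * e4

/-- If five points stayed on a circle, then q = 0 and ρ = pq = 0. The condition m ≠ 2 keeps the
weight of the sixth point nonzero nearby. -/
theorem isStronglyNonRigid_of_pentagon {m : ℝ} (hm : m ≠ 2) {N : ℕ}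
    (X : WeightedPoints 2 N) (hX : X.IsEuclideanDesign 4) (e : Fin N ≃ Fin 6) (ζ : ℂ) (hζ : ζ ≠ 0)
    (c : ℝ) (H : Hexad) (hH : H = ⟨1, 0, (√5 + 1) / 4, (√5 - 1) / 4, √(1 - ((√5 + 1) / 4) ^ 2),
      √(1 - ((√5 - 1) / 4) ^ 2), 2 / 5, m - 2, 2 / 5, 2 / 5⟩)
    (hZ0 : ∀ i, planeIsometry.symm (X.pt i) = ζ * H.pt (e i))
    (hW0 : ∀ i, X.wt i = c * H.wt (e i)) : X.IsStronglyNonRigid 4 := by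
  obtain ⟨hreg, hfam⟩ := family_pentagon m
  refine hreg.isStronglyNonRigid X hX e ζ hζ c (by rwa [hfam, ← hH]) (by rwa [hfam, ← hH]) ?_
  have h5 : √5 ^ 2 = (5 : ℝ) := Real.sq_sqrt (by norm_num)
  have h5pos : 0 < √(5 : ℝ) := Real.sqrt_pos.2 (by norm_num)
  have h5lt : √(5 : ℝ) < 3 := by nlinarith
  have n1 : ‖(family (1 / 4) m 0).pt 0‖ = ‖(family (1 / 4) m 0).pt 2‖ := by
    rw [norm_pt_two_eq_iff, hfam]
    simp only
    rw [Real.sq_sqrt (by nlinarith)]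
    ring
  have n2 : ‖(family (1 / 4) m 0).pt 0‖ = ‖(family (1 / 4) m 0).pt 4‖ := by
    rw [norm_pt_four_eq_iff, hfam]
    simp only
    rw [Real.sq_sqrt (by nlinarith)]
    ring
  have cp := (continuous_pFun (h := 1 / 4) (m := m)).continuousAt (x := 0)
  have cq := (continuous_qFun (h := 1 / 4) (m := m)).continuousAt (x := 0)
  have hp : pFun (1 / 4) m 0 = 1 := congrArg Hexad.p hfam
  have hq : qFun (1 / 4) m 0 = 0 := congrArg Hexad.q hfam
  have hB : bFun (1 / 4) m 0 = m - 2 := congrArg Hexad.B hfam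
  have ev1 := hreg.continuousAt_bFun.eventually_ne (y := 0) (by rw [hB]; exact sub_ne_zero.2 hm)
  have ev2 := ((cp.pow 2).sub (cq.pow 2)).eventually_ne (y := 0)
    (by rw [Pi.sub_apply, Pi.pow_apply, Pi.pow_apply, hp, hq]; norm_num)
  filter_upwards [(hreg.eventually.and (ev1.and ev2)).filter_mono
    nhdsWithin_le_nhds, self_mem_nhdsWithin] with ρ ⟨H', h1, h2⟩ hne
  by_contra hcon
  push Not at hcon
  have m1 := (norm_pt_two_eq_iff _).1 (hcon 0 2 n1)
  have m2 := (norm_pt_four_eq_iff _).1 (hcon 0 4 n2)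
  have e1 : qFun (1 / 4) m ρ = 0 :=
    H'.isBalanced.eq_zero_of_pentagon h1 (sub_ne_zero.1 h2) m1 m2
  have e3 := pFun_mul_qFun H'.disc_pos
  apply hne
  rw [Set.mem_singleton_iff, ← e3, e1, mul_zero]

end Hexad
end

/-! ### Dimension counts and classification of the planar tight 4-designs -/

noncomputable section
open scoped ComplexConjugate Topology

theorem finrank_restrictSupport {n : ℕ} (s : Set (Fin n →₀ ℕ)) :
    Module.finrank ℝ (MvPolynomial.restrictSupport ℝ s) = s.ncard :=
  Module.finrank_eq_nat_card_basis (MvPolynomial.basisRestrictSupport ℝ s)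

theorem finrank_restrictSupport_two (s : Set (Fin 2 →₀ ℕ)) (T : Finset (ℕ × ℕ))
    (h : ∀ m, m ∈ s ↔ (m 0, m 1) ∈ T) :
    Module.finrank ℝ (MvPolynomial.restrictSupport ℝ s) = T.card := by
  have hinj : Function.Injective fun m : Fin 2 →₀ ℕ => (m 0, m 1) := by
    intro m m' hmm
    simp only [Prod.mk.injEq] at hmm
    ext i
    fin_cases i
    · exact hmm.1
    · exact hmm.2
  rw [finrank_restrictSupport, ← Set.ncard_image_of_injective s hinj, ← Set.ncard_coe_finset]
  congr 1
  ext ⟨a, b⟩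
  simp only [Set.mem_image, Finset.mem_coe]
  constructor
  · rintro ⟨m, hm, he⟩
    rw [← he]
    exact (h m).1 hm
  · intro hab
    refine ⟨Finsupp.single 0 a + Finsupp.single 1 b, (h _).2 (by simpa using hab), by simp⟩

theorem finsupp_sum_two (m : Fin 2 →₀ ℕ) : (m.sum fun _ e => e) = m 0 + m 1 := by
  rw [Finsupp.sum_fintype _ _ (fun _ => rfl), Fin.sum_univ_two]

theorem finrank_polSpace_two_two : Module.finrank ℝ (polSpace 2 2) = 6 := by
  refine (finrank_restrictSupport_two _ {(0, 0), (1, 0), (0, 1), (2, 0), (1, 1), (0, 2)} ?_).trans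
    rfl
  intro m
  simp only [Set.mem_ofPred_eq, finsupp_sum_two, Finset.mem_insert, Finset.mem_singleton,
    Prod.mk.injEq]
  omega

theorem polStarSpace_eq (n e : ℕ) : polStarSpace n e = MvPolynomial.restrictSupport ℝ
    {m : Fin n →₀ ℕ | (m.sum fun _ e => e) ≤ e ∧ (m.sum fun _ e => e) ≡ e [MOD 2]} := by
  have hhom : ∀ i, MvPolynomial.homogeneousSubmodule (Fin n) ℝ i =
      MvPolynomial.restrictSupport ℝ {m : Fin n →₀ ℕ | (m.sum fun _ e => e) = i} := by
    intro i
    rw [MvPolynomial.homogeneousSubmodule_eq_finsupp_supported]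
    rfl
  apply le_antisymm
  · refine iSup₂_le fun i hi => ?_
    rw [hhom]
    refine MvPolynomial.restrictSupport_mono _ ?_
    rintro m rfl
    exact hi
  · rw [MvPolynomial.restrictSupport_eq_span, Submodule.span_le]
    rintro _ ⟨m, hm, rfl⟩
    refine Submodule.mem_iSup_of_mem (m.sum fun _ e => e) (Submodule.mem_iSup_of_mem hm ?_)
    rw [hhom, MvPolynomial.monomial_mem_restrictSupport]
    exact Or.inl rfl

theorem finrank_polStarSpace_two_two : Module.finrank ℝ (polStarSpace 2 2) = 4 := by
  rw [polStarSpace_eq]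
  refine (finrank_restrictSupport_two _ {(0, 0), (2, 0), (1, 1), (0, 2)} ?_).trans rfl
  intro m
  simp only [Set.mem_ofPred_eq, finsupp_sum_two, Finset.mem_insert, Finset.mem_singleton,
    Prod.mk.injEq, Nat.ModEq]
  omega

theorem finrank_polStarSpace_two_one : Module.finrank ℝ (polStarSpace 2 1) = 2 := by
  rw [polStarSpace_eq]
  refine (finrank_restrictSupport_two _ {(1, 0), (0, 1)} ?_).trans rfl
  intro m
  simp only [Set.mem_ofPred_eq, finsupp_sum_two, Finset.mem_insert, Finset.mem_singleton,
    Prod.mk.injEq, Nat.ModEq]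
  omega

/-- Because the counts agree, it is enough to locate each point of the design among the model
points; surjectivity is automatic. -/
theorem exists_equiv_of_points {N M : ℕ} (hN : N = M) {z : Fin N → ℂ} (hz : Function.Injective z)
    (w : Fin N → ℝ) (y : Fin M → ℂ) (v : Fin M → ℝ) (h : ∀ i, ∃ k, z i = y k ∧ w i = v k) :
    ∃ e : Fin N ≃ Fin M, (∀ i, z i = y (e i)) ∧ ∀ i, w i = v (e i) := by
  choose f hf using h
  have hinj : Function.Injective f := fun i j hij => hz (by rw [(hf i).1, (hf j).1, hij])
  exact ⟨Equiv.ofBijective f ((Fintype.bijective_iff_injective_and_card f).2 ⟨hinj, by simp [hN]⟩),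
    fun i => (hf i).1, fun i => (hf i).2⟩

theorem cube_roots (x : ℝ) {y : ℂ} (hy : y ^ 3 = (x : ℂ) ^ 3) :
    y = ⟨x, 0⟩ ∨ y = ⟨-(x / 2), x * √3 / 2⟩ ∨ y = ⟨-(x / 2), -(x * √3 / 2)⟩ := by
  have h3 : ((√3 : ℝ) : ℂ) ^ 2 = 3 := by exact_mod_cast Real.sq_sqrt (by norm_num : (0 : ℝ) ≤ 3)
  simp only [Complex.mk_eq_add_mul_I]
  push_cast
  rw [← sub_eq_zero, ← sub_eq_zero (b := _ + _), ← sub_eq_zero (a := y) (b := -((x : ℂ) / 2) + _),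
    ← mul_eq_zero, ← mul_eq_zero]
  linear_combination hy + (y - x) * ((x : ℂ) ^ 2 / 4) * h3 -
    (y - x) * (x ^ 2 * ((√3 : ℝ) : ℂ) ^ 2 / 4) * Complex.I_sq

/-- Over ℚ(√5), y⁵ - 1 = (y - 1)(y² + (√5+1)/2 y + 1)(y² - (√5-1)/2 y + 1). -/
theorem fifth_roots {y : ℂ} (hy : y ^ 5 = 1) :
    y = ⟨1, 0⟩ ∨ y = ⟨-((√5 + 1) / 4), √(1 - ((√5 + 1) / 4) ^ 2)⟩ ∨
      y = ⟨-((√5 + 1) / 4), -√(1 - ((√5 + 1) / 4) ^ 2)⟩ ∨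
      y = ⟨(√5 - 1) / 4, √(1 - ((√5 - 1) / 4) ^ 2)⟩ ∨
      y = ⟨(√5 - 1) / 4, -√(1 - ((√5 - 1) / 4) ^ 2)⟩ := by
  have h5 : √5 ^ 2 = (5 : ℝ) := Real.sq_sqrt (by norm_num)
  have h5pos : 0 < √(5 : ℝ) := Real.sqrt_pos.2 (by norm_num)
  have h5lt : √(5 : ℝ) < 3 := by nlinarith
  have hs : √(1 - ((√5 + 1) / 4) ^ 2) ^ 2 = (1 - ((√5 + 1) / 4) ^ 2 : ℝ) :=
    Real.sq_sqrt (by nlinarith)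
  have ht : √(1 - ((√5 - 1) / 4) ^ 2) ^ 2 = (1 - ((√5 - 1) / 4) ^ 2 : ℝ) :=
    Real.sq_sqrt (by nlinarith)
  generalize √(1 - ((√5 + 1) / 4) ^ 2) = s at *
  generalize √(1 - ((√5 - 1) / 4) ^ 2) = t at *
  generalize √(5 : ℝ) = c at *
  have h5' : (c : ℂ) ^ 2 = 5 := by exact_mod_cast h5
  have hs' : (s : ℂ) ^ 2 = 1 - ((c + 1) / 4) ^ 2 := by exact_mod_cast hs
  have ht' : (t : ℂ) ^ 2 = 1 - ((c - 1) / 4) ^ 2 := by exact_mod_cast ht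
  have e1 : (y - ⟨-((c + 1) / 4), s⟩) * (y - ⟨-((c + 1) / 4), -s⟩) =
      y ^ 2 + (c + 1) / 2 * y + 1 := by
    simp only [Complex.mk_eq_add_mul_I]
    push_cast
    linear_combination hs' - (s : ℂ) ^ 2 * Complex.I_sq
  have e2 : (y - ⟨(c - 1) / 4, t⟩) * (y - ⟨(c - 1) / 4, -t⟩) =
      y ^ 2 - (c - 1) / 2 * y + 1 := by
    simp only [Complex.mk_eq_add_mul_I]
    push_cast
    linear_combination ht' - (t : ℂ) ^ 2 * Complex.I_sq
  have e3 : (y - ⟨1, 0⟩) * (((y - ⟨-((c + 1) / 4), s⟩) * (y - ⟨-((c + 1) / 4), -s⟩)) *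
      ((y - ⟨(c - 1) / 4, t⟩) * (y - ⟨(c - 1) / 4, -t⟩))) = 0 := by
    rw [e1, e2, show (⟨1, 0⟩ : ℂ) = 1 from rfl]
    linear_combination hy - (y - 1) * y ^ 2 / 4 * h5'
  simp only [mul_eq_zero, sub_eq_zero] at e3
  tauto

namespace WeightedPoints

variable {N : ℕ}

/-- The points of a planar weighted set as complex numbers. -/
def cpt (X : WeightedPoints 2 N) (i : Fin N) : ℂ := planeIsometry.symm (X.pt i)

theorem norm_cpt (X : WeightedPoints 2 N) (i : Fin N) : ‖X.cpt i‖ = ‖X.pt i‖ :=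
  planeIsometry.symm.norm_map _

theorem cpt_injective (X : WeightedPoints 2 N) : Function.Injective X.cpt :=
  planeIsometry.symm.injective.comp X.pt_injective

theorem IsEuclideanDesign.moment_eq_zero {X : WeightedPoints 2 N} {t : ℕ}
    (hX : X.IsEuclideanDesign t) {a b : ℕ} (hab : a + b ≤ t) (hne : a ≠ b) :
    ∑ i, (X.wt i : ℂ) * (X.cpt i ^ a * conj (X.cpt i) ^ b) = 0 :=
  (X.isEuclideanDesign_iff_moments t).1 hX a b hab hne

theorem IsEuclideanDesign.power_moment_eq_zero {X : WeightedPoints 2 N} {t : ℕ}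
    (hX : X.IsEuclideanDesign t) {k : ℕ} (hk : 1 ≤ k) (hkt : k ≤ t) :
    ∑ i, (X.wt i : ℂ) * X.cpt i ^ k = 0 := by
  simpa using hX.moment_eq_zero (a := k) (b := 0) (by omega) (by omega)

/-- For a design supported by two concentric circles, the low power moments vanish on each of
the circles. -/
theorem IsEuclideanDesign.circle_moment_eq_zero {X : WeightedPoints 2 N} {t : ℕ}
    (hX : X.IsEuclideanDesign t) {r R : ℝ} (hr : 0 ≤ r) (hR : 0 ≤ R) (hrR : r ≠ R)
    (hrad : ∀ i, ‖X.cpt i‖ = r ∨ ‖X.cpt i‖ = R) {k : ℕ} (hk : 1 ≤ k) (hkt : k + 2 ≤ t) :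
    ∑ i with ‖X.cpt i‖ = r, (X.wt i : ℂ) * X.cpt i ^ k = 0 := by
  have h1 := hX.power_moment_eq_zero hk (by omega)
  -- On each circle this moment is the k-th one times the squared radius. Together with `h1` it
  -- forms a 2 × 2 system of determinant R² - r² up to sign; its degree accounts for k + 2 ≤ t.
  have h2 := hX.moment_eq_zero (a := k + 1) (b := 1) (by omega) (by omega)
  rw [← Finset.sum_filter_add_sum_filter_not Finset.univ (fun i => ‖X.cpt i‖ = r)] at h1 h2
  have e1 : ∑ i with ‖X.cpt i‖ = r, (X.wt i : ℂ) * (X.cpt i ^ (k + 1) * conj (X.cpt i) ^ 1) =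
      (r : ℂ) ^ 2 * ∑ i with ‖X.cpt i‖ = r, (X.wt i : ℂ) * X.cpt i ^ k := by
    rw [Finset.mul_sum]
    refine Finset.sum_congr rfl fun i hi => ?_
    have hc := Complex.mul_conj (X.cpt i)
    rw [Complex.normSq_eq_norm_sq, (Finset.mem_filter.1 hi).2] at hc
    push_cast at hc
    linear_combination (X.wt i : ℂ) * X.cpt i ^ k * hc
  have e2 : ∑ i with ¬‖X.cpt i‖ = r, (X.wt i : ℂ) * (X.cpt i ^ (k + 1) * conj (X.cpt i) ^ 1) =
      (R : ℂ) ^ 2 * ∑ i with ¬‖X.cpt i‖ = r, (X.wt i : ℂ) * X.cpt i ^ k := by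
    rw [Finset.mul_sum]
    refine Finset.sum_congr rfl fun i hi => ?_
    have hc := Complex.mul_conj (X.cpt i)
    rw [Complex.normSq_eq_norm_sq, (hrad i).resolve_left (Finset.mem_filter.1 hi).2] at hc
    push_cast at hc
    linear_combination (X.wt i : ℂ) * X.cpt i ^ k * hc
  rw [e1, e2] at h2
  have h3 : (r : ℂ) ^ 2 - (R : ℂ) ^ 2 ≠ 0 := by
    rw [sub_ne_zero]
    intro h
    exact hrR ((sq_eq_sq₀ hr hR).1 (by exact_mod_cast h))
  apply mul_left_cancel₀ h3
  linear_combination h2 - (R : ℂ) ^ 2 * h1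

theorem exists_two_radii (X : WeightedPoints 2 N) (h : X.radii.card = 2) :
    ∃ r R : ℝ, 0 ≤ R ∧ R < r ∧ (∀ i, ‖X.cpt i‖ = r ∨ ‖X.cpt i‖ = R) ∧
      (∃ i, ‖X.cpt i‖ = r) ∧ ∃ i, ‖X.cpt i‖ = R := by
  have key : ∀ a b : ℝ, X.radii = {a, b} → b < a → ∃ r R : ℝ, 0 ≤ R ∧ R < r ∧
      (∀ i, ‖X.cpt i‖ = r ∨ ‖X.cpt i‖ = R) ∧ (∃ i, ‖X.cpt i‖ = r) ∧ ∃ i, ‖X.cpt i‖ = R := by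
    intro a b hab hlt
    have hmem : ∀ c, c ∈ X.radii ↔ ∃ i, ‖X.cpt i‖ = c := by
      intro c
      simp [radii, norm_cpt]
    have hb : ∃ i, ‖X.cpt i‖ = b := (hmem b).1 (by simp [hab])
    refine ⟨a, b, ?_, hlt, fun i => ?_, (hmem a).1 (by simp [hab]), hb⟩
    · obtain ⟨i, hi⟩ := hb
      rw [← hi]
      exact norm_nonneg _
    · have := (hmem ‖X.cpt i‖).2 ⟨i, rfl⟩
      simpa [hab] using this
  obtain ⟨a, b, hab, heq⟩ := Finset.card_eq_two.1 h
  rcases lt_or_gt_of_ne hab with hlt | hlt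
  · exact key b a (by rw [heq, Finset.pair_comm]) hlt
  · exact key a b heq hlt

/-- The case of five points on a circle together with its centre. -/
theorem isStronglyNonRigid_of_center (hN : N = 6) (X : WeightedPoints 2 N)
    (hX : X.IsEuclideanDesign 4) {r : ℝ} (hr : 0 < r)
    (hrad : ∀ i, ‖X.cpt i‖ = r ∨ ‖X.cpt i‖ = 0) (hr' : ∃ i, ‖X.cpt i‖ = r)
    (h0 : ∃ i, ‖X.cpt i‖ = 0) : X.IsStronglyNonRigid 4 := by
  obtain ⟨i₀, hi₀⟩ := h0
  obtain ⟨i₁, hi₁⟩ := hr'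
  rw [norm_eq_zero] at hi₀
  set s : Finset (Fin N) := {i | ‖X.cpt i‖ = r} with hs
  have hsn : ∀ i ∈ s, ‖X.cpt i‖ = r := fun i hi => (Finset.mem_filter.1 hi).2
  have hnot : ∀ i, i ∉ s → i = i₀ := by
    intro i hi
    have : ‖X.cpt i‖ = 0 := (hrad i).resolve_left fun h =>
      hi (Finset.mem_filter.2 ⟨Finset.mem_univ _, h⟩)
    exact X.cpt_injective ((norm_eq_zero.1 this).trans hi₀.symm)
  have hi₁s : i₁ ∈ s := Finset.mem_filter.2 ⟨Finset.mem_univ _, hi₁⟩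
  have hi₀s : i₀ ∉ s := fun h => hr.ne' (by rw [← hsn i₀ h, hi₀, norm_zero])
  have hsE : s = Finset.univ.erase i₀ := by
    ext i
    simp only [Finset.mem_erase, Finset.mem_univ, and_true]
    exact ⟨fun h hi => hi₀s (hi ▸ h), fun h => by_contra fun h' => h (hnot i h')⟩
  have hcard : s.card = 4 + 1 := by
    rw [hsE, Finset.card_erase_of_mem (Finset.mem_univ _), Finset.card_univ, Fintype.card_fin, hN]
  have hw : 0 < ∑ i ∈ s, X.wt i := Finset.sum_pos (fun i _ => X.wt_pos i) ⟨i₁, hi₁s⟩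
  -- The centre contributes nothing to positive powers, so here all four moments vanish on the
  -- circle, which yields a regular pentagon.
  have hm : ∀ k, 1 ≤ k → k ≤ 4 → ∑ i ∈ s, (X.wt i : ℂ) * X.cpt i ^ k = 0 := by
    intro k hk hk4
    rw [hsE, ← hX.power_moment_eq_zero hk hk4]
    refine Finset.sum_erase _ ?_
    rw [hi₀, zero_pow (by omega), mul_zero]
  obtain ⟨c, hc⟩ := exists_pow_eq_of_moments hr hsn hw hm hcard
  have hwt := fun i hi => weight_eq_of_moments hr hsn hw X.cpt_injective.injOn hm hcard (i := i) hi
  set W := ∑ i ∈ s, X.wt i with hW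
  set ζ := X.cpt i₁ with hζ
  have hζ0 : ζ ≠ 0 := by rw [← norm_pos_iff, hi₁]; exact hr
  have hw0 := X.wt_pos i₀
  -- In the model the pentagon has total weight 2, so all weights are scaled by 2/W.
  set m := 2 + 2 * X.wt i₀ / W with hm'
  have hm2 : m ≠ 2 := by
    have : 0 < 2 * X.wt i₀ / W := by positivity
    rw [hm']
    linarith
  set H : Hexad := ⟨1, 0, (√5 + 1) / 4, (√5 - 1) / 4, √(1 - ((√5 + 1) / 4) ^ 2),
      √(1 - ((√5 - 1) / 4) ^ 2), 2 / 5, m - 2, 2 / 5, 2 / 5⟩ with hH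
  have hall : ∀ i, ∃ k, X.cpt i = ζ * H.pt k ∧ X.wt i = W / 2 * H.wt k := by
    intro i
    by_cases hi : i ∈ s
    · have h5 : (X.cpt i / ζ) ^ 5 = 1 := by
        rw [div_pow, hc i hi, ← hc i₁ hi₁s, div_self (pow_ne_zero _ hζ0)]
      have hwi : X.wt i = W / 2 * (2 / 5) := by
        have := hwt i hi
        push_cast at this
        linarith
      have hz : X.cpt i = ζ * (X.cpt i / ζ) := by field_simp
      rcases fifth_roots h5 with h | h | h | h | h <;> rw [h] at hz
      · exact ⟨0, hz, hwi⟩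
      · exact ⟨2, hz, hwi⟩
      · exact ⟨3, hz, hwi⟩
      · exact ⟨4, hz, hwi⟩
      · exact ⟨5, hz, hwi⟩
    · rw [hnot i hi]
      refine ⟨1, ?_, ?_⟩
      · have : H.pt 1 = 0 := by simp [hH, Hexad.pt, Complex.ext_iff]
        rw [this, mul_zero, hi₀]
      · have : H.wt 1 = m - 2 := rfl
        rw [this, hm']
        field_simp
        ring
  obtain ⟨e, he, he'⟩ := exists_equiv_of_points hN X.cpt_injective X.wt (fun k => ζ * H.pt k)
    (fun k => W / 2 * H.wt k) hall
  exact Hexad.isStronglyNonRigid_of_pentagon hm2 X hX e ζ hζ0 (W / 2) H hH he he'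

/-- The case of six points on two circles of positive radius. -/
theorem isStronglyNonRigid_of_two_circles (hN : N = 6) (X : WeightedPoints 2 N)
    (hX : X.IsEuclideanDesign 4) {r R : ℝ} (hR : 0 < R) (hRr : R < r)
    (hrad : ∀ i, ‖X.cpt i‖ = r ∨ ‖X.cpt i‖ = R) (hr' : ∃ i, ‖X.cpt i‖ = r)
    (hR' : ∃ i, ‖X.cpt i‖ = R) : X.IsStronglyNonRigid 4 := by
  obtain ⟨i₁, hi₁⟩ := hr'
  obtain ⟨i₂, hi₂⟩ := hR'
  have hr : 0 < r := hR.trans hRr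
  set s : Finset (Fin N) := {i | ‖X.cpt i‖ = r} with hs
  set s' : Finset (Fin N) := {i | ‖X.cpt i‖ = R} with hs'
  have hss' : s' = ({i | ¬‖X.cpt i‖ = r} : Finset (Fin N)) := by
    rw [hs']
    refine Finset.filter_congr fun i _ => ⟨fun h => by rw [h]; exact hRr.ne, fun h =>
      (hrad i).resolve_left h⟩
  have hsn : ∀ i ∈ s, ‖X.cpt i‖ = r := fun i hi => (Finset.mem_filter.1 hi).2
  have hsn' : ∀ i ∈ s', ‖X.cpt i‖ = R := fun i hi => (Finset.mem_filter.1 hi).2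
  have hi₁s : i₁ ∈ s := Finset.mem_filter.2 ⟨Finset.mem_univ _, hi₁⟩
  have hi₂s : i₂ ∈ s' := Finset.mem_filter.2 ⟨Finset.mem_univ _, hi₂⟩
  have hw : 0 < ∑ i ∈ s, X.wt i := Finset.sum_pos (fun i _ => X.wt_pos i) ⟨i₁, hi₁s⟩
  have hw' : 0 < ∑ i ∈ s', X.wt i := Finset.sum_pos (fun i _ => X.wt_pos i) ⟨i₂, hi₂s⟩
  have hm : ∀ k, 1 ≤ k → k ≤ 2 → ∑ i ∈ s, (X.wt i : ℂ) * X.cpt i ^ k = 0 := fun k hk hk2 =>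
    hX.circle_moment_eq_zero hr.le hR.le hRr.ne' hrad hk (by omega)
  have hm' : ∀ k, 1 ≤ k → k ≤ 2 → ∑ i ∈ s', (X.wt i : ℂ) * X.cpt i ^ k = 0 := fun k hk hk2 =>
    hX.circle_moment_eq_zero hR.le hr.le hRr.ne (fun i => (hrad i).symm) hk (by omega)
  have hc1 := lt_card_of_moments hr hsn hw hm
  have hc2 := lt_card_of_moments hR hsn' hw' hm'
  have hsum : s.card + s'.card = 6 := by
    rw [hss', hs, Finset.card_filter_add_card_filter_not, Finset.card_univ, Fintype.card_fin, hN]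
  -- Each circle needs at least three of the six points.
  have hcard : s.card = 2 + 1 := by omega
  have hcard' : s'.card = 2 + 1 := by omega
  obtain ⟨c, hc⟩ := exists_pow_eq_of_moments hr hsn hw hm hcard
  obtain ⟨c', hc'⟩ := exists_pow_eq_of_moments hR hsn' hw' hm' hcard'
  have hwt := fun i hi => weight_eq_of_moments hr hsn hw X.cpt_injective.injOn hm hcard (i := i) hi
  have hwt' := fun i hi =>
    weight_eq_of_moments hR hsn' hw' X.cpt_injective.injOn hm' hcard' (i := i) hi
  -- The third moment couples the circles: its argument makes the triangles opposite, its modulus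
  -- gives W r³ = W' R³.
  have hW3 : ((∑ i ∈ s, X.wt i : ℝ) : ℂ) * c + ((∑ i ∈ s', X.wt i : ℝ) : ℂ) * c' = 0 := by
    rw [← hX.power_moment_eq_zero (k := 3) (by norm_num) (by norm_num),
      ← Finset.sum_filter_add_sum_filter_not Finset.univ (fun i => ‖X.cpt i‖ = r), ← hss', ← hs]
    push_cast
    rw [Finset.sum_mul, Finset.sum_mul]
    congr 1
    · exact Finset.sum_congr rfl fun i hi => by rw [← hc i hi]
    · exact Finset.sum_congr rfl fun i hi => by rw [← hc' i hi]
  set W := ∑ i ∈ s, X.wt i with hW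
  set W' := ∑ i ∈ s', X.wt i with hW'
  set ζ := X.cpt i₁ with hζ
  have hζ0 : ζ ≠ 0 := by rw [← norm_pos_iff, hi₁]; exact hr
  have hWr : W * r ^ 3 = W' * R ^ 3 := by
    have h1 : ‖(W : ℂ) * c‖ = ‖(W' : ℂ) * c'‖ := by
      rw [eq_neg_of_add_eq_zero_left hW3, norm_neg]
    rw [norm_mul, norm_mul, ← hc i₁ hi₁s, ← hc' i₂ hi₂s, norm_pow, norm_pow, hi₁, hi₂,
      Complex.norm_of_nonneg hw.le, Complex.norm_of_nonneg hw'.le] at h1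
    exact h1
  set x := R / r with hx
  have hx0 : 0 < x := by positivity
  have hx1 : x < 1 := by rw [hx, div_lt_one hr]; exact hRr
  have hWx : W = W' * x ^ 3 := by
    rw [hx]; field_simp; linarith
  set H : Hexad := ⟨1, x, 1 / 2, x / 2, √3 / 2, x * √3 / 2, 2 * x / (3 * (1 + x)),
      2 / (3 * x ^ 2 * (1 + x)), 2 * x / (3 * (1 + x)), 2 / (3 * x ^ 2 * (1 + x))⟩ with hH
  have hall : ∀ i, ∃ k, X.cpt i = ζ * H.pt k ∧ X.wt i = W * (1 + x) / (2 * x) * H.wt k := by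
    intro i
    have hz : X.cpt i = ζ * (X.cpt i / ζ) := by field_simp
    by_cases hi : i ∈ s
    · have h3 : (X.cpt i / ζ) ^ 3 = ((1 : ℝ) : ℂ) ^ 3 := by
        rw [div_pow, hc i hi, ← hc i₁ hi₁s, div_self (pow_ne_zero _ hζ0)]
        simp
      have hwi : X.wt i = W * (1 + x) / (2 * x) * (2 * x / (3 * (1 + x))) := by
        have := hwt i hi
        push_cast at this
        field_simp
        linarith
      rcases cube_roots 1 h3 with h | h | h <;> rw [h] at hz
      · exact ⟨0, hz, hwi⟩
      · exact ⟨2, by rw [hz]; simp [H, Hexad.pt], hwi⟩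
      · exact ⟨3, by rw [hz]; simp [H, Hexad.pt], hwi⟩
    · have hi' : i ∈ s' := by
        rw [hss']
        exact Finset.mem_filter.2 ⟨Finset.mem_univ _,
          fun h => hi (Finset.mem_filter.2 ⟨Finset.mem_univ _, h⟩)⟩
      have h3 : (X.cpt i / ζ) ^ 3 = ((-x : ℝ) : ℂ) ^ 3 := by
        have hW0 : (W' : ℂ) ≠ 0 := by exact_mod_cast hw'.ne'
        have hWx' : (W : ℂ) = W' * x ^ 3 := by exact_mod_cast hWx
        rw [div_pow, div_eq_iff (pow_ne_zero _ hζ0), hc' i hi', hc i₁ hi₁s]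
        apply mul_left_cancel₀ hW0
        push_cast
        linear_combination hW3 - c * hWx'
      have hwi : X.wt i = W * (1 + x) / (2 * x) * (2 / (3 * x ^ 2 * (1 + x))) := by
        have := hwt' i hi'
        push_cast at this
        rw [hWx]
        field_simp
        linarith
      rcases cube_roots (-x) h3 with h | h | h <;> rw [h] at hz
      · exact ⟨1, hz, hwi⟩
      -- The scale -x changes the sign of the imaginary part, so the conjugate pair is matched in
      -- reverse order.
      · refine ⟨5, ?_, hwi⟩
        rw [hz]
        congr 1
        apply Complex.ext <;> simp [H, Hexad.pt] <;> ring
      · refine ⟨4, ?_, hwi⟩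
        rw [hz]
        congr 1
        apply Complex.ext <;> simp [H, Hexad.pt] <;> ring
  obtain ⟨e, he, he'⟩ := exists_equiv_of_points hN X.cpt_injective X.wt (fun k => ζ * H.pt k)
    (fun k => W * (1 + x) / (2 * x) * H.wt k) hall
  exact Hexad.isStronglyNonRigid_of_triangles hx0 hx1 X hX e ζ hζ0 _ H hH he he'

theorem isStronglyNonRigid_four (X : WeightedPoints 2 N) (hX : X.IsTightEuclideanEven 2)
    (hrad : X.radii.card = 2) : X.IsStronglyNonRigid 4 := by
  obtain ⟨hdes, hN, hdim⟩ := hX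
  rw [hdim, finrank_polSpace_two_two] at hN
  obtain ⟨r, R, hR, hRr, h1, h2, h3⟩ := X.exists_two_radii hrad
  rcases hR.eq_or_lt with rfl | hR
  · exact X.isStronglyNonRigid_of_center hN hdes hRr h1 h2 h3
  · exact X.isStronglyNonRigid_of_two_circles hN hdes hR hRr h1 h2 h3

end WeightedPoints
end

/-! ### Pairs of squares: the planar tight 5-designs -/

noncomputable section
open scoped ComplexConjugate Topology

theorem fourth_roots (x : ℝ) {y : ℂ} (hy : y ^ 4 = (x : ℂ) ^ 4) :
    y = ⟨x, 0⟩ ∨ y = ⟨-x, 0⟩ ∨ y = ⟨0, x⟩ ∨ y = ⟨0, -x⟩ := by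
  have h : (y - ⟨x, 0⟩) * ((y - ⟨-x, 0⟩) * ((y - ⟨0, x⟩) * (y - ⟨0, -x⟩))) = 0 := by
    simp only [Complex.mk_eq_add_mul_I]
    push_cast
    linear_combination hy - (y ^ 2 - (x : ℂ) ^ 2) * (x : ℂ) ^ 2 * Complex.I_sq
  simp only [mul_eq_zero, sub_eq_zero] at h
  exact h

/-- The identity (1 + i)⁴ = -4 is behind this form. -/
theorem fourth_roots_neg (x : ℝ) {y : ℂ} (hy : y ^ 4 = -(4 * (x : ℂ) ^ 4)) :
    y = ⟨x, x⟩ ∨ y = ⟨-x, -x⟩ ∨ y = ⟨x, -x⟩ ∨ y = ⟨-x, x⟩ := by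
  have h : ((y - ⟨x, x⟩) * (y - ⟨-x, -x⟩)) * ((y - ⟨x, -x⟩) * (y - ⟨-x, x⟩)) = 0 := by
    have e1 : (y - ⟨x, x⟩) * (y - ⟨-x, -x⟩) = y ^ 2 - 2 * (x : ℂ) ^ 2 * Complex.I := by
      simp only [Complex.mk_eq_add_mul_I]
      push_cast
      linear_combination -(x : ℂ) ^ 2 * Complex.I_sq
    have e2 : (y - ⟨x, -x⟩) * (y - ⟨-x, x⟩) = y ^ 2 + 2 * (x : ℂ) ^ 2 * Complex.I := by
      simp only [Complex.mk_eq_add_mul_I]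
      push_cast
      linear_combination -(x : ℂ) ^ 2 * Complex.I_sq
    rw [e1, e2]
    linear_combination hy - 4 * (x : ℂ) ^ 4 * Complex.I_sq
  simp only [mul_eq_zero, sub_eq_zero] at h
  tauto

namespace Octad

/-- Eight points of the plane, symmetric in both axes: `±1`, `±q i` and `±b ± c i`. -/
def pt (q b c : ℝ) : Fin 8 → ℂ :=
  ![⟨1, 0⟩, ⟨-1, 0⟩, ⟨0, q⟩, ⟨0, -q⟩, ⟨b, c⟩, ⟨-b, -c⟩, ⟨b, -c⟩, ⟨-b, c⟩]

/-- Weights on the points of `Octad.pt`. -/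
def wt (A B : ℝ) : Fin 8 → ℝ := ![A, A, B, B, 1 / 2, 1 / 2, 1 / 2, 1 / 2]

/-- Odd moments vanish by central symmetry and imaginary parts by reflection. What remains is z², z⁴
and z³ conj z; the sum and difference of the last two are `hA` and `hB`. -/
theorem moment_eq_zero {A B q b c : ℝ} (h2 : A + b ^ 2 = B * q ^ 2 + c ^ 2)
    (hA : A = b ^ 2 * (3 * c ^ 2 - b ^ 2)) (hB : B * q ^ 4 = c ^ 2 * (3 * b ^ 2 - c ^ 2))
    (m l : ℕ) (hml : m + l ≤ 5) (hlt : l < m) :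
    ∑ k, (wt A B k : ℂ) * (pt q b c k ^ m * conj (pt q b c k) ^ l) = 0 := by
  have hm : m ≤ 5 := by omega
  have hl : l ≤ 2 := by omega
  rw [Fin.sum_univ_eight]
  interval_cases m <;> interval_cases l <;> try omega
  all_goals
    simp only [wt, pt, Matrix.cons_val, Complex.ext_iff, pow_succ, pow_zero, one_mul, mul_one,
      Complex.add_re, Complex.add_im, Complex.mul_re, Complex.mul_im, Complex.ofReal_re,
      Complex.ofReal_im, Complex.conj_re, Complex.conj_im, Complex.zero_re, Complex.zero_im]
    refine ⟨?_, by ring⟩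
  · ring
  · linear_combination 2 * h2
  · ring
  · ring
  · linear_combination 2 * hA - 2 * hB
  · ring
  · linear_combination 2 * hA + 2 * hB
  · ring
  · ring

/-- The squared distance to the origin of the points on the imaginary axis, along the family. -/
def qSq (S τ : ℝ) : ℝ :=
  (S - τ) * (2 * S + 4 * τ) / ((S + τ) * (2 * S - 4 * τ) + 2 * τ)

/-- Put b² = S + τ and c² = S - τ. The fourth-degree conditions give A and Bq⁴, the second-degree
one gives Bq² = A + 2τ, and the quotient is `qSq`. The points ±1 and ±q i remain at equal distance
only if τ(2S - 1) = 0; the exception 2S = 1 is the regular octagon. -/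
theorem isStronglyNonRigid {S : ℝ} (hS : 0 < S) (hS1 : 2 * S ≠ 1) {N : ℕ}
    (X : WeightedPoints 2 N) (hX : X.IsEuclideanDesign 5) (e : Fin N ≃ Fin 8) (ζ : ℂ) (hζ : ζ ≠ 0)
    (c : ℝ) (hZ0 : ∀ i, X.cpt i = ζ * pt 1 √S √S (e i))
    (hW0 : ∀ i, X.wt i = c * wt (2 * S ^ 2) (2 * S ^ 2) (e i)) : X.IsStronglyNonRigid 5 := by
  have hden : (S + 0) * (2 * S - 4 * 0) + 2 * 0 ≠ 0 := by
    have : 0 < S ^ 2 := by positivity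
    nlinarith
  have q0 : qSq S 0 = 1 := by rw [qSq]; field_simp; ring
  have cq : ContinuousAt (qSq S) 0 := by
    unfold qSq
    exact ContinuousAt.div (by fun_prop) (by fun_prop) hden
  refine X.isStronglyNonRigid_of_planar_curve hX e ζ hζ c
    (fun τ => pt √(qSq S τ) √(S + τ) √(S - τ))
    (fun τ => wt ((S + τ) * (2 * S - 4 * τ)) ((S - τ) * (2 * S + 4 * τ) / qSq S τ ^ 2)) 0
    (fun i => ?_) (fun i => ?_) (fun i => ?_) (fun i => ?_) ?_ ?_
  · have h1 : ContinuousAt (fun τ => √(qSq S τ)) 0 := cq.sqrt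
    have h2 : ContinuousAt (fun τ => √(S + τ)) 0 := by fun_prop
    have h3 : ContinuousAt (fun τ => √(S - τ)) 0 := by fun_prop
    fin_cases i
    · exact continuousAt_const
    · exact continuousAt_const
    · exact Hexad.continuousAt_mk continuousAt_const h1
    · exact Hexad.continuousAt_mk continuousAt_const h1.neg
    · exact Hexad.continuousAt_mk h2 h3
    · exact Hexad.continuousAt_mk h2.neg h3.neg
    · exact Hexad.continuousAt_mk h2 h3.neg
    · exact Hexad.continuousAt_mk h2.neg h3
  · have h1 : ContinuousAt (fun τ => (S + τ) * (2 * S - 4 * τ)) 0 := by fun_prop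
    have h2 : ContinuousAt (fun τ => (S - τ) * (2 * S + 4 * τ) / qSq S τ ^ 2) 0 :=
      ContinuousAt.div (by fun_prop) (cq.pow 2) (by rw [q0]; norm_num)
    fin_cases i
    · exact h1
    · exact h1
    · exact h2
    · exact h2
    all_goals exact continuousAt_const
  · simp only [q0, Real.sqrt_one, add_zero, sub_zero]
    exact hZ0 i
  · simp only [q0, add_zero, sub_zero, mul_zero, one_pow, div_one,
      show S * (2 * S) = 2 * S ^ 2 by ring]
    exact hW0 i
  · have cden : ContinuousAt (fun τ => (S + τ) * (2 * S - 4 * τ) + 2 * τ) 0 := by fun_prop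
    have ev1 := cden.eventually_ne hden
    have ev2 := cq.eventually (lt_mem_nhds (show 0 < qSq S 0 by rw [q0]; norm_num))
    filter_upwards [(ev1.and (ev2.and ((gt_mem_nhds hS).and
      (lt_mem_nhds (show -S < 0 by linarith))))).filter_mono nhdsWithin_le_nhds]
      with τ ⟨h1, h2, h3, h4⟩ m l hml hlt
    have sq := Real.sq_sqrt h2.le
    have sb := Real.sq_sqrt (show 0 ≤ S + τ by linarith)
    have sc := Real.sq_sqrt (show 0 ≤ S - τ by linarith)
    have sq4 : √(qSq S τ) ^ 4 = qSq S τ ^ 2 := by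
      rw [show √(qSq S τ) ^ 4 = (√(qSq S τ) ^ 2) ^ 2 by ring, sq]
    refine moment_eq_zero ?_ ?_ ?_ m l hml hlt
    · rw [sq, sb, sc]
      have e1 : qSq S τ * ((S + τ) * (2 * S - 4 * τ) + 2 * τ) =
          (S - τ) * (2 * S + 4 * τ) := by rw [qSq, div_mul_cancel₀ _ h1]
      have e2 : (S - τ) * (2 * S + 4 * τ) / qSq S τ ^ 2 * qSq S τ =
          (S + τ) * (2 * S - 4 * τ) + 2 * τ := by
        rw [← e1]; field_simp
      linear_combination -e2
    · rw [sb, sc]; ring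
    · rw [sq4, sb, sc]
      field_simp
      ring
  · have cden : ContinuousAt (fun τ => (S + τ) * (2 * S - 4 * τ) + 2 * τ) 0 := by fun_prop
    have ev1 := cden.eventually_ne hden
    have ev2 := cq.eventually (lt_mem_nhds (show 0 < qSq S 0 by rw [q0]; norm_num))
    filter_upwards [(ev1.and ev2).filter_mono nhdsWithin_le_nhds, self_mem_nhdsWithin]
      with τ ⟨h1, h2⟩ hne
    refine ⟨0, 2, ?_, ?_⟩
    · rw [Hexad.norm_eq_norm_iff]
      simp [pt, q0]
    · rw [Ne, Hexad.norm_eq_norm_iff]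
      have sq := Real.sq_sqrt h2.le
      simp only [pt, Matrix.cons_val]
      rw [sq]
      intro h
      have e1 : qSq S τ * ((S + τ) * (2 * S - 4 * τ) + 2 * τ) =
          (S - τ) * (2 * S + 4 * τ) := by rw [qSq, div_mul_cancel₀ _ h1]
      have h' : qSq S τ = 1 := by linarith
      rw [h'] at e1
      have : τ * (2 * S - 1) = 0 := by linear_combination -e1 / 2
      rcases mul_eq_zero.1 this with h0 | h0
      · exact hne h0
      · exact hS1 (by linarith)

end Octad

namespace WeightedPoints

variable {N : ℕ}

/-- Away from the origin an antipodal half and its negative are disjoint, so N is twice the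
dimension 4. -/
theorem card_eq_eight (X : WeightedPoints 2 N) (hX : X.IsAntipodalTightEuclideanOdd 2)
    (h0 : ∀ i, X.pt i ≠ 0) : N = 8 := by
  obtain ⟨-, -, -, ⟨H, ⟨hH1, hH2⟩, hcard⟩, hdim⟩ := hX
  rw [hdim, finrank_polStarSpace_two_two] at hcard
  have hfin : (Set.range X.pt).Finite := Set.finite_range _
  have hsub : H ⊆ Set.range X.pt := by rw [← hH1]; exact Set.subset_union_left
  have hdisj : Disjoint H ((fun v => -v) '' H) := by
    rw [Set.disjoint_iff]
    intro v hv
    obtain rfl : v = 0 := hH2 hv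
    obtain ⟨i, hi⟩ := hsub hv.1
    exact h0 i hi
  have h1 : (Set.range X.pt).ncard = N := by
    rw [← Set.image_univ, Set.ncard_image_of_injective _ X.pt_injective, Set.ncard_univ]
    simp
  rw [← hH1, Set.ncard_union_eq hdisj (hfin.subset hsub) ((hfin.subset hsub).image _),
    Set.ncard_image_of_injective _ neg_injective, hcard] at h1
  exact h1.symm

theorem isStronglyNonRigid_five (X : WeightedPoints 2 N)
    (hT : X.IsAntipodalTightEuclideanOdd 2) (hradii : X.radii.card = 2) (h0 : ∀ i, X.pt i ≠ 0) :
    X.IsStronglyNonRigid 5 := by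
  have hN := X.card_eq_eight hT h0
  have hX : X.IsEuclideanDesign 5 := hT.1
  obtain ⟨r, R, hR, hRr, hrad, ⟨i₁, hi₁⟩, ⟨i₂, hi₂⟩⟩ := X.exists_two_radii hradii
  replace hR : 0 < R := by
    rw [← hi₂, norm_cpt]
    exact norm_pos_iff.2 (h0 i₂)
  have hr : 0 < r := hR.trans hRr
  set s : Finset (Fin N) := {i | ‖X.cpt i‖ = r} with hs
  set s' : Finset (Fin N) := {i | ‖X.cpt i‖ = R} with hs'
  have hss' : s' = ({i | ¬‖X.cpt i‖ = r} : Finset (Fin N)) := by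
    rw [hs']
    refine Finset.filter_congr fun i _ => ⟨fun h => by rw [h]; exact hRr.ne, fun h =>
      (hrad i).resolve_left h⟩
  have hsn : ∀ i ∈ s, ‖X.cpt i‖ = r := fun i hi => (Finset.mem_filter.1 hi).2
  have hsn' : ∀ i ∈ s', ‖X.cpt i‖ = R := fun i hi => (Finset.mem_filter.1 hi).2
  have hi₁s : i₁ ∈ s := Finset.mem_filter.2 ⟨Finset.mem_univ _, hi₁⟩
  have hi₂s : i₂ ∈ s' := Finset.mem_filter.2 ⟨Finset.mem_univ _, hi₂⟩
  have hw : 0 < ∑ i ∈ s, X.wt i := Finset.sum_pos (fun i _ => X.wt_pos i) ⟨i₁, hi₁s⟩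
  have hw' : 0 < ∑ i ∈ s', X.wt i := Finset.sum_pos (fun i _ => X.wt_pos i) ⟨i₂, hi₂s⟩
  have hm : ∀ k, 1 ≤ k → k ≤ 3 → ∑ i ∈ s, (X.wt i : ℂ) * X.cpt i ^ k = 0 := fun k hk hk2 =>
    hX.circle_moment_eq_zero hr.le hR.le hRr.ne' hrad hk (by omega)
  have hm' : ∀ k, 1 ≤ k → k ≤ 3 → ∑ i ∈ s', (X.wt i : ℂ) * X.cpt i ^ k = 0 := fun k hk hk2 =>
    hX.circle_moment_eq_zero hR.le hr.le hRr.ne (fun i => (hrad i).symm) hk (by omega)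
  have hc1 := lt_card_of_moments hr hsn hw hm
  have hc2 := lt_card_of_moments hR hsn' hw' hm'
  have hsum : s.card + s'.card = 8 := by
    rw [hss', hs, Finset.card_filter_add_card_filter_not, Finset.card_univ, Fintype.card_fin, hN]
  have hcard : s.card = 3 + 1 := by omega
  have hcard' : s'.card = 3 + 1 := by omega
  obtain ⟨c, hc⟩ := exists_pow_eq_of_moments hr hsn hw hm hcard
  obtain ⟨c', hc'⟩ := exists_pow_eq_of_moments hR hsn' hw' hm' hcard'
  have hwt := fun i hi => weight_eq_of_moments hr hsn hw X.cpt_injective.injOn hm hcard (i := i) hi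
  have hwt' := fun i hi =>
    weight_eq_of_moments hR hsn' hw' X.cpt_injective.injOn hm' hcard' (i := i) hi
  -- The fourth moment couples the two squares: they are turned by 45° against each other and W r⁴ =
  -- W' R⁴.
  have hW4 : ((∑ i ∈ s, X.wt i : ℝ) : ℂ) * c + ((∑ i ∈ s', X.wt i : ℝ) : ℂ) * c' = 0 := by
    rw [← hX.power_moment_eq_zero (k := 4) (by norm_num) (by norm_num),
      ← Finset.sum_filter_add_sum_filter_not Finset.univ (fun i => ‖X.cpt i‖ = r), ← hss', ← hs]
    push_cast
    rw [Finset.sum_mul, Finset.sum_mul]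
    congr 1
    · exact Finset.sum_congr rfl fun i hi => by rw [← hc i hi]
    · exact Finset.sum_congr rfl fun i hi => by rw [← hc' i hi]
  set W := ∑ i ∈ s, X.wt i with hW
  set W' := ∑ i ∈ s', X.wt i with hW'
  set ζ := X.cpt i₁ with hζ
  have hζ0 : ζ ≠ 0 := by rw [← norm_pos_iff, hi₁]; exact hr
  have hWr : W * r ^ 4 = W' * R ^ 4 := by
    have h1 : ‖(W : ℂ) * c‖ = ‖(W' : ℂ) * c'‖ := by
      rw [eq_neg_of_add_eq_zero_left hW4, norm_neg]
    rw [norm_mul, norm_mul, ← hc i₁ hi₁s, ← hc' i₂ hi₂s, norm_pow, norm_pow, hi₁, hi₂,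
      Complex.norm_of_nonneg hw.le, Complex.norm_of_nonneg hw'.le] at h1
    exact h1
  -- Relative to ζ the inner square has vertices √S(±1 ± i), of modulus R/r.
  set S := (R / r) ^ 2 / 2 with hS
  have hS0 : 0 < S := by positivity
  have hS1 : 2 * S ≠ 1 := by
    have : R / r < 1 := by rw [div_lt_one hr]; exact hRr
    have h0 : 0 < R / r := by positivity
    rw [hS]
    nlinarith
  have hWS : W = W' * (4 * S ^ 2) := by
    rw [hS]; field_simp; linarith
  have hS4 : √S ^ 4 = S ^ 2 := by
    rw [show √S ^ 4 = (√S ^ 2) ^ 2 by ring, Real.sq_sqrt hS0.le]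
  have hall : ∀ i, ∃ k, X.cpt i = ζ * Octad.pt 1 √S √S k ∧
      X.wt i = W' / 2 * Octad.wt (2 * S ^ 2) (2 * S ^ 2) k := by
    intro i
    have hz : X.cpt i = ζ * (X.cpt i / ζ) := by field_simp
    by_cases hi : i ∈ s
    · have h4 : (X.cpt i / ζ) ^ 4 = ((1 : ℝ) : ℂ) ^ 4 := by
        rw [div_pow, hc i hi, ← hc i₁ hi₁s, div_self (pow_ne_zero _ hζ0)]
        simp
      have hwi : X.wt i = W' / 2 * (2 * S ^ 2) := by
        have := hwt i hi
        push_cast at this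
        linarith
      rcases fourth_roots 1 h4 with h | h | h | h <;> rw [h] at hz
      · exact ⟨0, hz, hwi⟩
      · exact ⟨1, hz, hwi⟩
      · exact ⟨2, hz, hwi⟩
      · exact ⟨3, hz, hwi⟩
    · have hi' : i ∈ s' := by
        rw [hss']
        exact Finset.mem_filter.2 ⟨Finset.mem_univ _,
          fun h => hi (Finset.mem_filter.2 ⟨Finset.mem_univ _, h⟩)⟩
      have h4 : (X.cpt i / ζ) ^ 4 = -(4 * ((√S : ℝ) : ℂ) ^ 4) := by
        have hW0 : (W' : ℂ) ≠ 0 := by exact_mod_cast hw'.ne'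
        have hWx' : (W : ℂ) = W' * (4 * ((√S : ℝ) : ℂ) ^ 4) := by
          rw [← hS4] at hWS
          exact_mod_cast hWS
        rw [div_pow, div_eq_iff (pow_ne_zero _ hζ0), hc' i hi', hc i₁ hi₁s]
        apply mul_left_cancel₀ hW0
        linear_combination hW4 - c * hWx'
      have hwi : X.wt i = W' / 2 * (1 / 2) := by
        have := hwt' i hi'
        push_cast at this
        linarith
      rcases fourth_roots_neg √S h4 with h | h | h | h <;> rw [h] at hz
      · exact ⟨4, hz, hwi⟩
      · exact ⟨5, hz, hwi⟩
      · exact ⟨6, hz, hwi⟩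
      · exact ⟨7, hz, hwi⟩
  obtain ⟨e, he, he'⟩ := exists_equiv_of_points hN X.cpt_injective X.wt
    (fun k => ζ * Octad.pt 1 √S √S k)
    (fun k => W' / 2 * Octad.wt (2 * S ^ 2) (2 * S ^ 2) k) hall
  exact Octad.isStronglyNonRigid hS0 hS1 X hX e ζ hζ0 _ he he'

end WeightedPoints
end

/-! ### Polynomials of degree one on the sphere, and the square as a 3-design -/

noncomputable section
open scoped ComplexConjugate Topology

theorem dimOn_eq_finrank {n : ℕ} (V : Submodule ℝ (MvPolynomial (Fin n) ℝ))
    (S : Set (EuclideanSpace ℝ (Fin n)))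
    (h : ∀ f ∈ V, (∀ v ∈ S, polyValue f v = 0) → f = 0) : dimOn V S = Module.finrank ℝ V := by
  rw [dimOn, ← LinearMap.range_domRestrict]
  refine LinearMap.finrank_range_of_inj ?_
  rw [← LinearMap.ker_eq_bot, LinearMap.ker_eq_bot']
  rintro ⟨f, hf⟩ h0
  refine Subtype.ext (h f hf fun v hv => ?_)
  exact congrFun h0 ⟨v, hv⟩

theorem exists_eq_add_single {n : ℕ} {m : Fin n →₀ ℕ} (hm : m ≠ 0) :
    ∃ m' k, m = m' + Finsupp.single k 1 := by
  obtain ⟨k, hk⟩ := Finsupp.ne_iff.1 hm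
  refine ⟨m - Finsupp.single k 1, k, (tsub_add_cancel_of_le ?_).symm⟩
  exact Finsupp.single_le_iff.2 (Nat.one_le_iff_ne_zero.2 hk)

theorem finsupp_sum_add_single {n : ℕ} (m : Fin n →₀ ℕ) (k : Fin n) :
    ((m + Finsupp.single k 1).sum fun _ e => e) = (m.sum fun _ e => e) + 1 := by
  rw [Finsupp.sum_add_index' (fun _ => rfl) (fun _ _ _ => rfl), Finsupp.sum_single_index rfl]

theorem finsupp_sum_le_one_iff {n : ℕ} (m : Fin n →₀ ℕ) :
    (m.sum fun _ e => e) ≤ 1 ↔ m = 0 ∨ ∃ k, m = Finsupp.single k 1 := by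
  constructor
  · intro h
    by_cases h0 : m = 0
    · exact Or.inl h0
    · obtain ⟨m', k, rfl⟩ := exists_eq_add_single h0
      rw [finsupp_sum_add_single] at h
      by_cases h0' : m' = 0
      · exact Or.inr ⟨k, by rw [h0', zero_add]⟩
      · obtain ⟨m'', l, rfl⟩ := exists_eq_add_single h0'
        rw [finsupp_sum_add_single] at h
        omega
  · rintro (rfl | ⟨k, rfl⟩) <;> simp

theorem finsupp_sum_le_two {n : ℕ} {m : Fin n →₀ ℕ} (h : (m.sum fun _ e => e) ≤ 2) :
    m = 0 ∨ (∃ k, m = Finsupp.single k 1) ∨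
      ∃ j k, m = Finsupp.single j 1 + Finsupp.single k 1 := by
  by_cases h0 : m = 0
  · exact Or.inl h0
  · obtain ⟨m', k, rfl⟩ := exists_eq_add_single h0
    rw [finsupp_sum_add_single] at h
    rcases (finsupp_sum_le_one_iff m').1 (by omega) with rfl | ⟨j, rfl⟩
    · exact Or.inr (Or.inl ⟨k, zero_add _⟩)
    · exact Or.inr (Or.inr ⟨j, k, rfl⟩)

theorem finrank_polSpace_one (n : ℕ) : Module.finrank ℝ (polSpace n 1) = n + 1 := by
  have hset : {m : Fin n →₀ ℕ | (m.sum fun _ e => e) ≤ 1} =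
      insert 0 (Set.range fun k : Fin n => Finsupp.single k 1) := by
    ext m
    rw [Set.mem_ofPred_eq, finsupp_sum_le_one_iff]
    simp [eq_comm]
  refine (finrank_restrictSupport _).trans ?_
  have hinj : Function.Injective fun k : Fin n => (Finsupp.single k 1 : Fin n →₀ ℕ) :=
    Finsupp.single_left_injective one_ne_zero
  rw [hset, Set.ncard_insert_of_notMem, ← Set.image_univ, Set.ncard_image_of_injective _ hinj,
    Set.ncard_univ]
  · simp
  · rintro ⟨k, hk⟩
    simp at hk

theorem polyValue_of_mem_polSpace_one {n : ℕ} {f : MvPolynomial (Fin n) ℝ} (hf : f ∈ polSpace n 1)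
    (v : EuclideanSpace ℝ (Fin n)) :
    polyValue f v = f.coeff 0 + ∑ k, f.coeff (Finsupp.single k 1) * v k := by
  have hinj : Function.Injective fun k : Fin n => (Finsupp.single k 1 : Fin n →₀ ℕ) :=
    Finsupp.single_left_injective one_ne_zero
  have hsub : f.support ⊆ insert 0 (Finset.univ.image fun k : Fin n => Finsupp.single k 1) := by
    intro m hm
    have := (finsupp_sum_le_one_iff m).1 (hf hm)
    simpa [eq_comm] using this
  rw [polyValue, MvPolynomial.eval_eq', Finset.sum_subset hsub, Finset.sum_insert,
    Finset.sum_image hinj.injOn]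
  · congr 1
    · simp
    · refine Finset.sum_congr rfl fun k _ => ?_
      congr 1
      rw [Finset.prod_eq_single k] <;> simp +contextual [eq_comm]
  · simp
  · intro m _ hm
    rw [MvPolynomial.notMem_support_iff.1 hm, zero_mul]

/-- The values at ± the basis vectors already determine the coefficients; a basis vector must exist,
hence 0 < n. -/
theorem eq_zero_of_mem_polSpace_one {n : ℕ} (hn : 0 < n) {f : MvPolynomial (Fin n) ℝ}
    (hf : f ∈ polSpace n 1)
    (h : ∀ v : EuclideanSpace ℝ (Fin n), ‖v‖ = 1 → polyValue f v = 0) : f = 0 := by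
  have key : ∀ k : Fin n, ∀ ε : ℝ, |ε| = 1 → f.coeff 0 + f.coeff (Finsupp.single k 1) * ε = 0 := by
    intro k ε hε
    have := h (EuclideanSpace.single k ε) (by simpa using hε)
    rw [polyValue_of_mem_polSpace_one hf, Finset.sum_eq_single k] at this
    · simpa using this
    · intro j _ hj
      simp [hj]
    · simp
  ext m
  rw [MvPolynomial.coeff_zero]
  by_cases hm : m ∈ f.support
  · rcases (finsupp_sum_le_one_iff m).1 (hf hm) with rfl | ⟨k, rfl⟩
    · have h1 := key ⟨0, hn⟩ 1 (by simp)
      have h2 := key ⟨0, hn⟩ (-1) (by simp)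
      linarith
    · have h1 := key k 1 (by simp)
      have h2 := key k (-1) (by simp)
      linarith
  · exact MvPolynomial.notMem_support_iff.1 hm

theorem polStarSpace_two_one_le : polStarSpace 2 1 ≤ polSpace 2 1 := by
  rw [polStarSpace_eq]
  exact MvPolynomial.restrictSupport_mono _ fun m hm => hm.1

namespace WeightedPoints

variable {n N : ℕ}

theorem support_eq_of_unit (X : WeightedPoints n N) [Nonempty (Fin N)] (h : ∀ i, ‖X.pt i‖ = 1) :
    X.support = {v | ‖v‖ = 1} := by
  ext v
  simp [support, radii, h, eq_comm]

/-- A spherical design with constant weight is a Euclidean design. -/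
theorem isEuclideanDesign_of_spherical (X : WeightedPoints n N) {t : ℕ}
    (h : IsSphericalDesign X.pt t) {c : ℝ} (hc : ∀ i, X.wt i = c) : X.IsEuclideanDesign t := by
  intro f hf
  rw [X.sum_radii_mul fun r => sphereAverage r (polyValue f)]
  rcases Nat.eq_zero_or_pos N with rfl | hN
  · simp
  · have hN' : (N : ℝ) ≠ 0 := by exact_mod_cast hN.ne'
    simp only [h.2.1, hc, h.2.2 f hf, ← Finset.mul_sum, Finset.sum_const, Finset.card_univ,
      Fintype.card_fin, nsmul_eq_mul]
    field_simp

end WeightedPoints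

namespace Square

/-- Two pairs of antipodal points on perpendicular lines. -/
def pt (a : ℝ) : Fin 4 → ℂ := ![⟨a, 0⟩, ⟨-a, 0⟩, ⟨0, 1⟩, ⟨0, -1⟩]

/-- Weights on the points of `Square.pt`. -/
def wt (a : ℝ) : Fin 4 → ℝ := ![1 / a ^ 2, 1 / a ^ 2, 1, 1]

/-- Odd degrees cancel in antipodal pairs, and the weight 1/a² makes the second moment along the
stretched axis independent of a. -/
theorem moment_eq_zero {a : ℝ} (ha : a ≠ 0) (m l : ℕ) (hml : m + l ≤ 3) (hlt : l < m) :
    ∑ k, (wt a k : ℂ) * (pt a k ^ m * conj (pt a k) ^ l) = 0 := by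
  have hm : m ≤ 3 := by omega
  have hl : l ≤ 1 := by omega
  have h2 : 1 / a ^ 2 * a ^ 2 = 1 := by field_simp
  rw [Fin.sum_univ_four]
  interval_cases m <;> interval_cases l <;> try omega
  all_goals
    simp only [wt, pt, Matrix.cons_val, Complex.ext_iff, pow_succ, pow_zero, one_mul, mul_one,
      Complex.add_re, Complex.add_im, Complex.mul_re, Complex.mul_im, Complex.ofReal_re,
      Complex.ofReal_im, Complex.conj_re, Complex.conj_im, Complex.zero_re, Complex.zero_im]
    refine ⟨?_, by ring⟩
  · ring
  · linear_combination 2 * h2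
  · ring
  · ring

end Square

namespace WeightedPoints

variable {N : ℕ}

/-- A tight spherical `3`-design on the circle is a square. -/
theorem exists_equiv_square (X : WeightedPoints 2 N) (hT : IsTightSphericalDesign X.pt 3)
    {c : ℝ} (hc : ∀ i, X.wt i = c) : ∃ (e : Fin N ≃ Fin 4) (ζ : ℂ), ‖ζ‖ = 1 ∧
      ∀ i, X.cpt i = ζ * Square.pt 1 (e i) := by
  have hN : N = 4 := hT.2
  have hX := X.isEuclideanDesign_of_spherical hT.1 hc
  have hn : ∀ i ∈ (Finset.univ : Finset (Fin N)), ‖X.cpt i‖ = 1 := fun i _ => by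
    rw [norm_cpt]; exact hT.1.2.1 i
  have i₁ : Fin N := ⟨0, by omega⟩
  have hw : 0 < ∑ i, X.wt i :=
    Finset.sum_pos (fun i _ => X.wt_pos i) ⟨i₁, Finset.mem_univ _⟩
  have hcard : (Finset.univ : Finset (Fin N)).card = 3 + 1 := by simp [hN]
  obtain ⟨d, hd⟩ := exists_pow_eq_of_moments one_pos hn hw
    (fun k hk hk3 => hX.power_moment_eq_zero hk hk3) hcard
  have hζ : ‖X.cpt i₁‖ = 1 := hn i₁ (Finset.mem_univ _)
  have hζ0 : X.cpt i₁ ≠ 0 := by rw [← norm_pos_iff, hζ]; exact one_pos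
  have hall : ∀ i, ∃ k, X.cpt i = X.cpt i₁ * Square.pt 1 k ∧ X.wt i = c := by
    intro i
    have hz : X.cpt i = X.cpt i₁ * (X.cpt i / X.cpt i₁) := by field_simp
    have h4 : (X.cpt i / X.cpt i₁) ^ 4 = ((1 : ℝ) : ℂ) ^ 4 := by
      rw [div_pow, hd i (Finset.mem_univ _), ← hd i₁ (Finset.mem_univ _),
        div_self (pow_ne_zero _ hζ0)]
      simp
    rcases fourth_roots 1 h4 with h | h | h | h <;> rw [h] at hz
    · exact ⟨0, hz, hc i⟩
    · exact ⟨1, hz, hc i⟩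
    · exact ⟨2, hz, hc i⟩
    · exact ⟨3, hz, hc i⟩
  obtain ⟨e, he, -⟩ := exists_equiv_of_points hN X.cpt_injective X.wt
    (fun k => X.cpt i₁ * Square.pt 1 k) (fun _ => c) hall
  exact ⟨e, X.cpt i₁, hζ, he⟩

theorem isStronglyNonRigid_three (X : WeightedPoints 2 N) (hT : IsTightSphericalDesign X.pt 3)
    {c : ℝ} (hc : ∀ i, X.wt i = c) : X.IsStronglyNonRigid 3 := by
  obtain ⟨e, ζ, hζ, he⟩ := X.exists_equiv_square hT hc
  have hζ0 : ζ ≠ 0 := by rw [← norm_pos_iff, hζ]; exact one_pos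
  refine X.isStronglyNonRigid_of_planar_curve (X.isEuclideanDesign_of_spherical hT.1 hc) e ζ hζ0 c
    Square.pt Square.wt 1 (fun i => ?_) (fun i => ?_) he (fun i => ?_) ?_ ?_
  · fin_cases i
    · exact Hexad.continuousAt_mk continuousAt_id continuousAt_const
    · exact Hexad.continuousAt_mk continuousAt_id.neg continuousAt_const
    · exact continuousAt_const
    · exact continuousAt_const
  · have : ContinuousAt (fun a : ℝ => 1 / a ^ 2) 1 :=
      ContinuousAt.div (by fun_prop) (by fun_prop) (by norm_num)
    fin_cases i
    · exact this
    · exact this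
    · exact continuousAt_const
    · exact continuousAt_const
  · have : ∀ k, Square.wt 1 k = 1 := by
      intro k
      fin_cases k <;> simp [Square.wt]
    rw [this, mul_one, hc]
  · filter_upwards [(eventually_ne_nhds (one_ne_zero (α := ℝ))).filter_mono nhdsWithin_le_nhds]
      with a ha m l hml hlt
    exact Square.moment_eq_zero ha m l hml hlt
  · filter_upwards [(lt_mem_nhds (one_pos (α := ℝ))).filter_mono nhdsWithin_le_nhds,
      self_mem_nhdsWithin] with a ha hne
    refine ⟨0, 2, ?_, ?_⟩
    · rw [Hexad.norm_eq_norm_iff]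
      simp [Square.pt]
    · rw [Ne, Hexad.norm_eq_norm_iff]
      simp only [Square.pt, Matrix.cons_val]
      intro h
      apply hne
      rw [Set.mem_singleton_iff]
      nlinarith

theorem isAntipodalTightEuclideanOdd_one (X : WeightedPoints 2 N)
    (hT : IsTightSphericalDesign X.pt 3) (hanti : IsAntipodal X.pt)
    {c : ℝ} (hc : ∀ i, X.wt i = c) : X.IsAntipodalTightEuclideanOdd 1 := by
  obtain ⟨e, ζ, hζ, he⟩ := X.exists_equiv_square hT hc
  have hζ0 : ζ ≠ 0 := by rw [← norm_pos_iff, hζ]; exact one_pos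
  have hN : N = 4 := hT.2
  have hne : Nonempty (Fin N) := ⟨⟨0, by omega⟩⟩
  have hdim : dimOn (polStarSpace 2 1) X.support = Module.finrank ℝ (polStarSpace 2 1) := by
    refine dimOn_eq_finrank _ _ fun f hf h => ?_
    rw [X.support_eq_of_unit hT.1.2.1] at h
    exact eq_zero_of_mem_polSpace_one two_pos (polStarSpace_two_one_le hf) h
  -- Two adjacent vertices of the square form an antipodal half.
  refine ⟨X.isEuclideanDesign_of_spherical hT.1 hc, hanti, fun i j _ => by rw [hc, hc],
    ⟨{planeIsometry ζ, planeIsometry (ζ * Complex.I)}, ⟨?_, ?_⟩, ?_⟩, hdim⟩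
  · have hpt : ∀ k, X.pt (e.symm k) = planeIsometry (ζ * Square.pt 1 k) := by
      intro k
      have := he (e.symm k)
      rw [Equiv.apply_symm_apply] at this
      rw [← this, cpt, LinearIsometryEquiv.apply_symm_apply]
    have p0 : (Square.pt 1 0 : ℂ) = 1 := rfl
    have p1 : (Square.pt 1 1 : ℂ) = -1 := by simp [Square.pt, Complex.ext_iff]
    have p2 : (Square.pt 1 2 : ℂ) = Complex.I := rfl
    have p3 : (Square.pt 1 3 : ℂ) = -Complex.I := by simp [Square.pt, Complex.ext_iff]
    rw [← e.symm.surjective.range_comp X.pt]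
    ext v
    simp only [Set.mem_union, Set.mem_image, Set.mem_range, Function.comp_apply, hpt]
    constructor
    · rintro ((rfl | rfl) | ⟨_, rfl | rfl, rfl⟩)
      · exact ⟨0, by rw [p0, mul_one]⟩
      · exact ⟨2, by rw [p2]⟩
      · exact ⟨1, by rw [p1, mul_neg, mul_one, map_neg]⟩
      · exact ⟨3, by rw [p3, mul_neg, map_neg]⟩
    · rintro ⟨k, rfl⟩
      fin_cases k
      · exact Or.inl (Or.inl (by simp [p0]))
      · exact Or.inr ⟨_, Or.inl rfl, by simp [p1]⟩
      · exact Or.inl (Or.inr (by simp [p2]))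
      · exact Or.inr ⟨_, Or.inr rfl, by simp [p3]⟩
  · have key : ∀ x y : ℂ, x ∈ ({1, Complex.I} : Set ℂ) → y ∈ ({1, Complex.I} : Set ℂ) →
        ζ * x ≠ -(ζ * y) := by
      intro x y hx hy h
      have h' : x = -y := mul_left_cancel₀ hζ0 (by rw [h, mul_neg])
      rcases hx with rfl | rfl <;> rcases hy with rfl | rfl <;>
        simp [Complex.ext_iff] at h' <;> norm_num at h'
    have mem : ∀ v, v ∈ ({planeIsometry ζ, planeIsometry (ζ * Complex.I)} : Set _) →
        ∃ x ∈ ({1, Complex.I} : Set ℂ), v = planeIsometry (ζ * x) := by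
      rintro v (rfl | rfl)
      · exact ⟨1, Or.inl rfl, by rw [mul_one]⟩
      · exact ⟨Complex.I, Or.inr rfl, rfl⟩
    rintro v ⟨hv, w, hw, rfl⟩
    obtain ⟨x, hx, hvx⟩ := mem _ hv
    obtain ⟨y, hy, rfl⟩ := mem _ hw
    refine absurd (planeIsometry.injective ?_) (key x y hx hy)
    rw [map_neg]
    exact hvx.symm
  · rw [hdim, finrank_polStarSpace_two_one, Set.ncard_pair]
    intro h
    have := mul_left_cancel₀ hζ0 ((mul_one ζ).trans (planeIsometry.injective h))
    simp [Complex.ext_iff] at this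

end WeightedPoints
end

/-! ### Second moments and 2-designs in ℝⁿ -/

noncomputable section
open scoped Topology

/-- The isometry that changes the sign of the `k`-th coordinate. -/
def signFlip {n : ℕ} (k : Fin n) : EuclideanSpace ℝ (Fin n) ≃ₗᵢ[ℝ] EuclideanSpace ℝ (Fin n) :=
  LinearIsometryEquiv.piLpCongrRight 2 fun i =>
    if i = k then LinearIsometryEquiv.neg ℝ else LinearIsometryEquiv.refl ℝ ℝ

theorem signFlip_apply {n : ℕ} (k j : Fin n) (v : EuclideanSpace ℝ (Fin n)) :
    signFlip k v j = if j = k then -v j else v j := by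
  by_cases h : j = k <;> simp [signFlip, h]

theorem polyMap_apply {n : ℕ} (f : MvPolynomial (Fin n) ℝ) (v : EuclideanSpace ℝ (Fin n)) :
    polyMap f v = MvPolynomial.eval (fun k => v k) f := rfl

theorem meanFunctional_X {n : ℕ} (r : ℝ) (k : Fin n) :
    meanFunctional ℝ n r (polyMap (MvPolynomial.X k)) = 0 := by
  have h := meanFunctional_eq_of_invariant (𝕜 := ℝ) r (signFlip k)
    (polyMap (MvPolynomial.X k)) (-polyMap (MvPolynomial.X k)) fun v => by
      simp [polyMap_apply, signFlip_apply]
  rw [map_neg] at h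
  linarith

theorem meanFunctional_X_mul_X_of_ne {n : ℕ} (r : ℝ) {j k : Fin n} (hjk : j ≠ k) :
    meanFunctional ℝ n r (polyMap (MvPolynomial.X j * MvPolynomial.X k)) = 0 := by
  have h := meanFunctional_eq_of_invariant (𝕜 := ℝ) r (signFlip k)
    (polyMap (MvPolynomial.X j * MvPolynomial.X k))
    (-polyMap (MvPolynomial.X j * MvPolynomial.X k)) fun v => by
      simp [polyMap_apply, signFlip_apply, hjk]
  rw [map_neg] at h
  linarith

/-- Coordinate swaps make the n squares have equal means, and these add up to r². -/
theorem meanFunctional_X_mul_X_self {n : ℕ} (hn : n ≠ 0) (r : ℝ) (k : Fin n) :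
    n * meanFunctional ℝ n r (polyMap (MvPolynomial.X k * MvPolynomial.X k)) = r ^ 2 := by
  have hswap : ∀ j, meanFunctional ℝ n r (polyMap (MvPolynomial.X j * MvPolynomial.X j)) =
      meanFunctional ℝ n r (polyMap (MvPolynomial.X k * MvPolynomial.X k)) := fun j =>
    meanFunctional_eq_of_invariant (𝕜 := ℝ) r
      (LinearIsometryEquiv.piLpCongrLeft 2 ℝ ℝ (Equiv.swap j k)) _ _ fun v => by
        simp [polyMap_apply, LinearIsometryEquiv.piLpCongrLeft_apply, Equiv.piCongrLeft'_apply]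
  have hsum : meanFunctional ℝ n r
      (∑ j, polyMap (MvPolynomial.X j * MvPolynomial.X j : MvPolynomial (Fin n) ℝ)) = r ^ 2 := by
    refine meanFunctional_eq_const hn r _ _ fun v hv => ?_
    rw [← sq_abs, ← hv, EuclideanSpace.norm_sq_eq]
    simp only [ContinuousMap.sum_apply, polyMap_apply, map_mul, MvPolynomial.eval_X,
      Real.norm_eq_abs, sq_abs]
    exact Finset.sum_congr rfl fun j _ => by ring
  rw [map_sum, Finset.sum_congr rfl fun j _ => hswap j] at hsum
  simpa using hsum

/-- `polyMap` as a linear map. -/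
def polyMapLinear (n : ℕ) : MvPolynomial (Fin n) ℝ →ₗ[ℝ] C(EuclideanSpace ℝ (Fin n), ℝ) where
  toFun := polyMap
  map_add' f g := by ext v; simp [polyMap_apply]
  map_smul' c f := by ext v; simp [polyMap_apply]

namespace WeightedPoints

variable {n N : ℕ}

/-- Vanishing first moments and a scalar second-moment matrix make a Euclidean `2`-design. -/
theorem isEuclideanDesign_two_of_moments (X : WeightedPoints n N) (hn : n ≠ 0)
    (h1 : ∀ k, ∑ i, X.wt i * X.pt i k = 0) {c : ℝ}
    (h2 : ∀ j k, ∑ i, X.wt i * (X.pt i j * X.pt i k) = if j = k then c else 0) :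
    X.IsEuclideanDesign 2 := by
  rw [isEuclideanDesign_iff_defect]
  have hker : MvPolynomial.restrictTotalDegree (Fin n) ℝ 2 ≤
      LinearMap.ker (X.defect ℝ ∘ₗ polyMapLinear n) := by
    rw [MvPolynomial.restrictTotalDegree, MvPolynomial.restrictSupport_eq_span, Submodule.span_le]
    rintro _ ⟨m, hm, rfl⟩
    rw [SetLike.mem_coe, LinearMap.mem_ker]
    change X.defect ℝ (polyMap (MvPolynomial.monomial m 1)) = 0
    rw [defect_apply]
    simp only [RCLike.ofReal_real_eq_id, id]
    rcases finsupp_sum_le_two hm with rfl | ⟨k, rfl⟩ | ⟨j, k, rfl⟩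
    · refine Finset.sum_eq_zero fun i _ => ?_
      rw [meanFunctional_eq_const hn _ 1 _ fun v _ => by simp [polyMap_apply]]
      simp [polyMap_apply]
    · change ∑ i, X.wt i * (polyMap (MvPolynomial.X k) (X.pt i) -
        meanFunctional ℝ n ‖X.pt i‖ (polyMap (MvPolynomial.X k))) = 0
      simp only [meanFunctional_X, sub_zero, polyMap_apply, MvPolynomial.eval_X]
      exact h1 k
    · have hmon : (MvPolynomial.monomial (Finsupp.single j 1 + Finsupp.single k 1) 1 :
          MvPolynomial (Fin n) ℝ) = MvPolynomial.X j * MvPolynomial.X k := by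
        rw [MvPolynomial.X, MvPolynomial.X, MvPolynomial.monomial_mul, one_mul]
      rw [hmon]
      by_cases hjk : j = k
      · subst hjk
        have hn' : (n : ℝ) ≠ 0 := by exact_mod_cast hn
        have hmean : ∀ r, meanFunctional ℝ n r (polyMap (MvPolynomial.X j * MvPolynomial.X j)) =
            r ^ 2 / n := fun r => by
          rw [eq_div_iff hn', mul_comm]
          exact meanFunctional_X_mul_X_self hn r j
        -- The trace of the second-moment matrix supplies the spherical side of the formula for a
        -- squared coordinate.
        have htr : ∑ i, X.wt i * ‖X.pt i‖ ^ 2 = n * c := by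
          simp only [EuclideanSpace.norm_sq_eq, Real.norm_eq_abs, sq_abs, Finset.mul_sum]
          rw [Finset.sum_comm]
          calc _ = ∑ _k : Fin n, c := Finset.sum_congr rfl fun k _ => by
                simpa [sq] using h2 k k
            _ = n * c := by simp
        have h2' := h2 j j
        rw [if_pos rfl] at h2'
        simp only [hmean, mul_sub, Finset.sum_sub_distrib, polyMap_apply, map_mul,
          MvPolynomial.eval_X, mul_div_assoc']
        rw [h2', ← Finset.sum_div, htr]
        field_simp
        ring
      · simp only [meanFunctional_X_mul_X_of_ne _ hjk, sub_zero, polyMap_apply, map_mul,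
          MvPolynomial.eval_X]
        simpa [hjk] using h2 j k
  intro f hf
  exact LinearMap.mem_ker.1 (hker ((MvPolynomial.mem_restrictTotalDegree _ _ _).2 hf))

end WeightedPoints

theorem IsSphericalDesign.sum_coord {n N t : ℕ} {x : Fin N → EuclideanSpace ℝ (Fin n)}
    (h : IsSphericalDesign x t) (ht : 1 ≤ t) (hN : N ≠ 0) (k : Fin n) : ∑ i, x i k = 0 := by
  have := h.2.2 (MvPolynomial.X k) (by simpa using ht)
  rw [sphereAverage_eq, meanFunctional_X, eq_comm, mul_eq_zero] at this
  have hN' : (N : ℝ) ≠ 0 := by exact_mod_cast hN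
  simpa [polyValue] using this.resolve_left (by positivity)

theorem IsSphericalDesign.sum_coord_mul {n N t : ℕ} {x : Fin N → EuclideanSpace ℝ (Fin n)}
    (h : IsSphericalDesign x t) (ht : 2 ≤ t) (hN : N ≠ 0) (j k : Fin n) :
    ∑ i, x i j * x i k = if j = k then (N : ℝ) / n else 0 := by
  have hN' : (N : ℝ) ≠ 0 := by exact_mod_cast hN
  have := h.2.2 (MvPolynomial.X j * MvPolynomial.X k)
    ((MvPolynomial.totalDegree_mul _ _).trans (by simpa using ht))
  rw [sphereAverage_eq] at this
  simp only [polyValue, map_mul, MvPolynomial.eval_X] at this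
  split_ifs with hjk
  · subst hjk
    have hn : n ≠ 0 := by rintro rfl; exact j.elim0
    have hn' : (n : ℝ) ≠ 0 := by exact_mod_cast hn
    have h2 := meanFunctional_X_mul_X_self hn 1 j
    rw [this] at h2
    field_simp at h2 ⊢
    linarith
  · rw [meanFunctional_X_mul_X_of_ne _ hjk, eq_comm, mul_eq_zero] at this
    exact this.resolve_left (by positivity)
end

/-! ### The regular simplex and its deformation -/

noncomputable section
open scoped Topology

namespace IsTightSphericalDesign

variable {n N : ℕ} {x : Fin N → EuclideanSpace ℝ (Fin n)}

theorem card_eq (h : IsTightSphericalDesign x 2) (hn : 2 ≤ n) : N = n + 1 := by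
  obtain ⟨k, rfl⟩ : ∃ k, n = k + 1 := ⟨n - 1, by omega⟩
  have := h.2
  simpa [Nat.choose_succ_self_right] using this

/-- A tight spherical `2`-design is a regular simplex. -/
theorem inner_eq (h : IsTightSphericalDesign x 2) (hn : 2 ≤ n) {i l : Fin N} (hil : i ≠ l) :
    inner ℝ (x i) (x l) = -1 / n := by
  have hN := h.card_eq hn
  have hn' : (n : ℝ) ≠ 0 := by exact_mod_cast (by omega : n ≠ 0)
  have hN' : (N : ℝ) = n + 1 := by rw [hN]; push_cast; ring
  have hinner : ∀ i, inner ℝ (x i) (x l) = ∑ k, x i k * x l k := fun i => by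
    rw [PiLp.inner_apply]
    exact Finset.sum_congr rfl fun k _ => by simp [mul_comm]
  have hll : inner ℝ (x l) (x l) = (1 : ℝ) := by
    rw [real_inner_self_eq_norm_sq, h.1.2.1 l, one_pow]
  have h1 : ∑ i, inner ℝ (x i) (x l) = 0 := by
    simp only [hinner]
    rw [Finset.sum_comm]
    refine Finset.sum_eq_zero fun k _ => ?_
    rw [← Finset.sum_mul, h.1.sum_coord one_le_two (by omega), zero_mul]
  have h2 : ∑ i, inner ℝ (x i) (x l) ^ 2 = ((n : ℝ) + 1) / n := by
    calc ∑ i, inner ℝ (x i) (x l) ^ 2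
        = ∑ i, ∑ j, ∑ k, x l j * x l k * (x i j * x i k) := by
          refine Finset.sum_congr rfl fun i _ => ?_
          rw [hinner, sq, Finset.sum_mul_sum]
          refine Finset.sum_congr rfl fun j _ => Finset.sum_congr rfl fun k _ => by ring
      _ = ∑ j, ∑ k, x l j * x l k * ∑ i, x i j * x i k := by
          rw [Finset.sum_comm]
          refine Finset.sum_congr rfl fun j _ => ?_
          rw [Finset.sum_comm]
          exact Finset.sum_congr rfl fun k _ => by rw [Finset.mul_sum]
      _ = inner ℝ (x l) (x l) * (((n : ℝ) + 1) / n) := by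
          rw [hinner, Finset.sum_mul]
          refine Finset.sum_congr rfl fun j _ => ?_
          rw [Finset.sum_eq_single j]
          · rw [h.1.sum_coord_mul le_rfl (by omega), if_pos rfl, hN']
          · intro k _ hk
            rw [h.1.sum_coord_mul le_rfl (by omega), if_neg hk.symm, mul_zero]
          · simp
      _ = _ := by rw [hll, one_mul]
  rw [← Finset.add_sum_erase _ _ (Finset.mem_univ l), hll] at h1 h2
  have hcard : (((Finset.univ : Finset (Fin N)).erase l).card : ℝ) = n := by
    rw [Finset.card_erase_of_mem (Finset.mem_univ _), Finset.card_univ, Fintype.card_fin, hN]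
    simp
  -- The n inner products with x l have sum -1 and sum of squares 1/n, the equality case of
  -- Cauchy–Schwarz, so each of them is -1/n.
  have h3 : ∑ i ∈ Finset.univ.erase l, (inner ℝ (x i) (x l) + 1 / (n : ℝ)) ^ 2 = 0 := by
    calc _ = ∑ i ∈ Finset.univ.erase l, inner ℝ (x i) (x l) ^ 2 +
          2 / n * ∑ i ∈ Finset.univ.erase l, inner ℝ (x i) (x l) +
          (((Finset.univ : Finset (Fin N)).erase l).card : ℝ) * (1 / n) ^ 2 := by
          rw [Finset.mul_sum, ← nsmul_eq_mul, ← Finset.sum_const, ← Finset.sum_add_distrib,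
            ← Finset.sum_add_distrib]
          exact Finset.sum_congr rfl fun i _ => by ring
      _ = 0 := by
          rw [hcard, eq_sub_of_add_eq' h2, eq_sub_of_add_eq' h1]
          field_simp
          ring
  have h4 := (Finset.sum_eq_zero_iff_of_nonneg fun i _ => sq_nonneg _).1 h3 i
    (Finset.mem_erase.2 ⟨hil, Finset.mem_univ _⟩)
  have h5 := pow_eq_zero_iff two_ne_zero |>.1 h4
  rw [neg_div]
  linarith

end IsTightSphericalDesign

namespace WeightedPoints

variable {n N : ℕ}

theorem isTightEuclideanEven_one (X : WeightedPoints n N) (hn : 2 ≤ n)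
    (hT : IsTightSphericalDesign X.pt 2) {c : ℝ} (hc : ∀ i, X.wt i = c) :
    X.IsTightEuclideanEven 1 := by
  have hN := hT.card_eq hn
  have hne : Nonempty (Fin N) := ⟨⟨0, by omega⟩⟩
  have hdim : dimOn (polSpace n 1) X.support = Module.finrank ℝ (polSpace n 1) := by
    refine dimOn_eq_finrank _ _ fun f hf h => ?_
    rw [X.support_eq_of_unit hT.1.2.1] at h
    exact eq_zero_of_mem_polSpace_one (by omega) hf h
  exact ⟨X.isEuclideanDesign_of_spherical hT.1 hc, by rw [hdim, finrank_polSpace_one, hN], hdim⟩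

/-- Moving the apex of a regular simplex along its axis, and the opposite face parallel to
itself. -/
theorem isStronglyNonRigid_two (X : WeightedPoints n N) (hn : 2 ≤ n)
    (hT : IsTightSphericalDesign X.pt 2) {c : ℝ} (hc : ∀ i, X.wt i = c) :
    X.IsStronglyNonRigid 2 := by
  have hN := hT.card_eq hn
  have hn0 : 0 < (n : ℝ) := by exact_mod_cast (by omega : 0 < n)
  have hN' : (N : ℝ) = n + 1 := by rw [hN]; push_cast; ring
  let l : Fin N := ⟨0, by omega⟩
  let i₀ : Fin N := ⟨1, by omega⟩
  have hil : i₀ ≠ l := by simp [i₀, l]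
  set e := X.pt l with he
  -- The face lies at height -τ on the axis. The apex weight ncτ/a makes the first moment vanish,
  -- and the axial second moment ncτ(a + τ) must equal the transverse one c(n+1)/n; this determines
  -- a.
  set a : ℝ → ℝ := fun τ => (n + 1) / (n ^ 2 * τ) - τ with ha
  have hτ0 : 0 < 1 / (n : ℝ) := by positivity
  have ca : ContinuousAt a (1 / n) :=
    ContinuousAt.sub (ContinuousAt.div (by fun_prop) (by fun_prop) (by positivity)) continuousAt_id
  have a0 : a (1 / n) = 1 := by
    simp only [ha]
    field_simp
    ring
  have hpos : ∀ᶠ τ in 𝓝 (1 / (n : ℝ)), 0 < τ ∧ 0 < a τ :=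
    (lt_mem_nhds hτ0).and (ca.eventually (lt_mem_nhds (by rw [a0]; exact one_pos)))
  set P : ℝ → Fin N → EuclideanSpace ℝ (Fin n) := fun τ i =>
    if i = l then a τ • e else X.pt i + (1 / n - τ) • e with hP
  set W : ℝ → Fin N → ℝ := fun τ i => if i = l then n * c * τ / a τ else c with hW
  have hPl : ∀ τ, P τ l = a τ • e := fun τ => if_pos rfl
  have hPi : ∀ τ i, i ≠ l → P τ i = X.pt i + (1 / (n : ℝ) - τ) • e := fun τ i hi => if_neg hi
  have hWl : ∀ τ, W τ l = n * c * τ / a τ := fun τ => if_pos rfl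
  have hWi : ∀ τ i, i ≠ l → W τ i = c := fun τ i hi => if_neg hi
  refine X.isStronglyNonRigid_of_curve (X.isEuclideanDesign_of_spherical hT.1 hc) P W (1 / n)
    (fun i => ?_) (fun i => ?_) (fun i => ?_) (fun i => ?_) ?_
  · by_cases hi : i = l
    · subst hi
      simp only [hPl]
      exact ca.smul continuousAt_const
    · simp only [hPi _ i hi]
      fun_prop
  · by_cases hi : i = l
    · subst hi
      simp only [hWl]
      exact ContinuousAt.div (by fun_prop) ca (by rw [a0]; exact one_ne_zero)
    · simp only [hWi _ i hi]
      exact continuousAt_const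
  · by_cases hi : i = l
    · rw [hi, hPl, a0, one_smul]
    · rw [hPi _ i hi, sub_self, zero_smul, add_zero]
  · by_cases hi : i = l
    · rw [hi, hWl, a0, hc]
      field_simp
    · rw [hWi _ i hi, hc]
  · filter_upwards [hpos.filter_mono nhdsWithin_le_nhds, self_mem_nhdsWithin]
      with τ ⟨hτ, haτ⟩ hne
    have haτ' : a τ * (n ^ 2 * τ) = n + 1 - n ^ 2 * τ ^ 2 := by
      simp only [ha]
      field_simp
    constructor
    · intro Y hYp hYw
      have hcard : (((Finset.univ : Finset (Fin N)).erase l).card : ℝ) = n := by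
        rw [Finset.card_erase_of_mem (Finset.mem_univ _), Finset.card_univ, Fintype.card_fin, hN]
        simp
      have s1 : ∀ k, ∑ i ∈ Finset.univ.erase l, X.pt i k = -e k := by
        intro k
        have := hT.1.sum_coord one_le_two (by omega) k
        rw [← Finset.add_sum_erase _ _ (Finset.mem_univ l)] at this
        exact eq_neg_of_add_eq_zero_right this
      have s2 : ∀ j k, ∑ i ∈ Finset.univ.erase l, X.pt i j * X.pt i k =
          (if j = k then ((n : ℝ) + 1) / n else 0) - e j * e k := by
        intro j k
        have := hT.1.sum_coord_mul le_rfl (by omega) j k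
        rw [← Finset.add_sum_erase _ _ (Finset.mem_univ l), hN'] at this
        exact eq_sub_of_add_eq' this
      have hYl : ∀ k, Y.pt l k = a τ * e k := fun k => by rw [hYp, hPl]; simp
      have hYi : ∀ i, i ≠ l → ∀ k, Y.pt i k = X.pt i k + (1 / n - τ) * e k := fun i hi k => by
        rw [hYp, hPi _ i hi]; simp
      have hYwl : Y.wt l * a τ = n * c * τ := by rw [hYw, hWl]; field_simp
      have hYwi : ∀ i, i ≠ l → Y.wt i = c := fun i hi => by rw [hYw, hWi _ i hi]
      refine Y.isEuclideanDesign_two_of_moments (by omega) (c := c * ((n + 1) / n))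
        (fun k => ?_) (fun j k => ?_)
      · rw [← Finset.add_sum_erase _ _ (Finset.mem_univ l)]
        calc _ = Y.wt l * (a τ * e k) + (c * ∑ i ∈ Finset.univ.erase l, X.pt i k +
              (((Finset.univ : Finset (Fin N)).erase l).card : ℝ) * (c * ((1 / n - τ) * e k))) := by
              rw [Finset.mul_sum, ← nsmul_eq_mul, ← Finset.sum_const, ← Finset.sum_add_distrib,
                hYl]
              congr 1
              refine Finset.sum_congr rfl fun i hi => ?_
              rw [hYwi i (Finset.ne_of_mem_erase hi), hYi i (Finset.ne_of_mem_erase hi)]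
              ring
          _ = 0 := by
              rw [s1, hcard, ← mul_assoc, hYwl]
              field_simp
              ring
      · rw [← Finset.add_sum_erase _ _ (Finset.mem_univ l)]
        calc _ = Y.wt l * (a τ * e j * (a τ * e k)) +
              (c * ∑ i ∈ Finset.univ.erase l, X.pt i j * X.pt i k +
              c * (1 / n - τ) * e k * ∑ i ∈ Finset.univ.erase l, X.pt i j +
              c * (1 / n - τ) * e j * ∑ i ∈ Finset.univ.erase l, X.pt i k +
              (((Finset.univ : Finset (Fin N)).erase l).card : ℝ) *
                (c * (1 / n - τ) ^ 2 * (e j * e k))) := by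
              rw [Finset.mul_sum, Finset.mul_sum, Finset.mul_sum, ← nsmul_eq_mul,
                ← Finset.sum_const, ← Finset.sum_add_distrib, ← Finset.sum_add_distrib,
                ← Finset.sum_add_distrib, hYl, hYl]
              congr 1
              refine Finset.sum_congr rfl fun i hi => ?_
              rw [hYwi i (Finset.ne_of_mem_erase hi), hYi i (Finset.ne_of_mem_erase hi),
                hYi i (Finset.ne_of_mem_erase hi)]
              ring
          _ = c * (if j = k then ((n : ℝ) + 1) / n else 0) := by
              rw [s1, s1, s2, hcard]
              have h1 : n * τ * a τ = (n + 1) / n - n * τ ^ 2 := by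
                field_simp
                linear_combination haτ'
              have h2 : (n : ℝ) * (1 / n - τ) ^ 2 - 2 * (1 / n - τ) - 1 =
                  n * τ ^ 2 - (n + 1) / n := by
                field_simp
                ring
              linear_combination a τ * e j * e k * hYwl + c * e j * e k * h1 + c * e j * e k * h2
          _ = _ := by split_ifs <;> simp
    · refine ⟨l, i₀, hil.symm, by rw [hT.1.2.1, hT.1.2.1], fun h => ?_⟩
      rw [hPl, hPi _ i₀ hil] at h
      have h2 := congrArg (· ^ 2) h
      rw [norm_smul, mul_pow, norm_add_sq_real, norm_smul, mul_pow, inner_smul_right,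
        hT.inner_eq hn hil, he, hT.1.2.1, hT.1.2.1, Real.norm_eq_abs, Real.norm_eq_abs, sq_abs,
        sq_abs] at h2
      set δ := 1 / (n : ℝ) - τ with hδ
      have hδ0 : δ ≠ 0 := fun h0 => hne (by rw [Set.mem_singleton_iff]; linarith)
      -- K is the factor in a - 1 = δK. Cancelling δ from the equality of squared norms leaves K(1 +
      -- a) = -1/n - τ, impossible because the left side is positive.
      set K := (1 / (n : ℝ) + τ + 1) / τ with hK
      have hKpos : 0 < K := by positivity
      have haK : a τ = 1 + δ * K := by
        simp only [ha, hδ, hK]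
        field_simp
        ring
      have h3 : δ * (K + K * a τ) = δ * (-(1 / n) - τ) := by
        rw [haK] at h2 ⊢
        linear_combination h2 + δ * hδ
      have h4 := mul_left_cancel₀ hδ0 h3
      have : 0 < K * a τ := mul_pos hKpos haτ
      linarith

end WeightedPoints
end

theorem theorem3p8 :
    (∀ n N : ℕ, 2 ≤ n → ∀ X : WeightedPoints n N,
      IsTightSphericalDesign X.pt 2 → (∃ c : ℝ, ∀ i, X.wt i = c) →
        X.IsTightEuclideanEven 1 ∧ X.IsStronglyNonRigid 2) ∧
    (∀ (N : ℕ) (X : WeightedPoints 2 N),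
      IsTightSphericalDesign X.pt 3 → IsAntipodal X.pt → (∃ c : ℝ, ∀ i, X.wt i = c) →
        X.IsAntipodalTightEuclideanOdd 1 ∧ X.IsStronglyNonRigid 3) ∧
    (∀ (N : ℕ) (X : WeightedPoints 2 N),
      X.IsTightEuclideanEven 2 → X.radii.card = 2 → X.IsStronglyNonRigid 4) ∧
    (∀ (N : ℕ) (X : WeightedPoints 2 N),
      X.IsAntipodalTightEuclideanOdd 2 → X.radii.card = 2 → (∀ i, X.pt i ≠ 0) →
        X.IsStronglyNonRigid 5) := by
  refine ⟨fun n N hn X hT ⟨c, hc⟩ =>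
      ⟨X.isTightEuclideanEven_one hn hT hc, X.isStronglyNonRigid_two hn hT hc⟩,
    fun N X hT hanti ⟨c, hc⟩ =>
      ⟨X.isAntipodalTightEuclideanOdd_one hT hanti hc, X.isStronglyNonRigid_three hT hc⟩,
    fun N X hT hrad => X.isStronglyNonRigid_four hT hrad,
    fun N X hT hrad h0 => X.isStronglyNonRigid_five hT hrad h0⟩
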